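/- **Theorem (Asymptotic distribution under homoskedasticity).** *Model.* Fix $d,K,L$ and $\beta^0\in\mathbb R^K$. Along a sequence of samples with dimensions $N_1,\dots,N_d$ (all quantities below may depend on the sample; limits are along the sequence) put $N=\prod_{n=1}^d N_n$ and write $i=(i_1,\dots,i_d)$ with $1\le i_n\le N_n$. Observe $$Y_i=\sum_{k=1}^K X_{i;k}\beta^0_k+\mathcal A_i+\varepsilon_i,\qquad \mathcal A_i=\sum_{\ell=1}^L\prod_{n=1}^d\varphi^{(n)}_{i_n\ell},$$ with random $X_i\in\mathbb R^K$, $\varphi^{(n)}_{i_n}\in\mathbb R^L$, $\varepsilon_i\in\mathbb R$. Let $\Gamma_{X}=\mathbb E(X\mid\mathcal A)$ (conditioning on the tensor $\mathcal A$) and $\eta=X-\Gamma_X$. Let $\widehat\Gamma_X,\widehat{\mathcal A},\widetilde\beta$ be preliminary estimates of $\Gamma_X,\mathcal A,\beta^0$, and $$\widehat\eta=X-\widehat\Gamma_X,\quad \widehat\Gamma_Y=\widehat\Gamma_X\cdot\widetilde\beta+\widehat{\mathcal A},\quad \widehat\Omega_X=\tfrac1N\sum_i\widehat\eta_i\widehat\eta_i',\quad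 \widehat\beta_{IC}=\widehat\Omega_X^{-1}\,\tfrac1N\sum_i\widehat\eta_i\,(Y_i-\widehat\Gamma_{Y,i}).$$ Let $\widehat\varphi^{(n)}_{i_n}\in\mathbb R^L$ be proxies, $k$ a kernel, $h_n$ bandwidths, $W_n$ the $N_n\times N_n$ matrix with entries $k(\|\widehat\varphi^{(n)}_{i}-\widehat\varphi^{(n)}_{j}\|/h_n)\big/\sum_{j'}k(\|\widehat\varphi^{(n)}_{i}-\widehat\varphi^{(n)}_{j'}\|/h_n)$, and $\check X_k=X_k\times_1(I-W_1)\times_2\cdots\times_d(I-W_d)$, where $\times_n$ is the $n$-mode product. "wpa1" means with probability approaching one. *Assumptions.* 1. (Kernel) $k\ge0$ is non-increasing in $|u|$, $\int k=1$, $\int u^2k(u)\,du<\infty$, and $k(u)\lesssim u^{-\delta}$ as $u\to\infty$ for some $\delta>2$. 2. (Proxies) $h_n>0$, $h_n\to0$, $N_nh_n\to\infty$, and for every $n$ and $e>0$, $\frac1{N_n}\sum_{i_n}\sum_{i_n'\ne i_n}\mathbb 1\{\|\widehat\varphi^{(n)}_{i_n'}-\widehat\varphi^{(n)}_{i_n}\|<h_ne\}>0$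 wpa1. 3. (Regularity) $\frac1N\sum_i\check X_i\check X_i'$ converges in probability to a nonrandom positive definite matrix, and $\frac1N\sum_i\check X_i\varepsilon_i=O_p(N^{-1/2})$. 4. (Proxy rates) For a non-empty $\mathcal M'\subset\{1,\dots,d\}$ and sequences $C_n>0$ with $C_n^{-2}\to0$, $\frac1{N_n}\sum_{i_n}\|\varphi^{(n)}_{i_n}-\widehat\varphi^{(n)}_{i_n}\|^2$ is $O_p(C_n^{-2})$ for $n\in\mathcal M'$ and $O_p(1)$ for $n\notin\mathcal M'$. 5. (Bai-type conditions) (i) $\mathbb E\|X_i\|^4$ is bounded. (ii) $\mathbb E\|\varphi^{(n)}_{i_n}\|^4$ is bounded; for each $n$ there is a fixed $r_n$ such that the mode-$n$ flattening of $\mathcal A$ has rank $r_n$ wpa1, and $\frac1{N_n}\sum_{i_n}\varphi^{(n)}_{i_n}\varphi^{(n)\prime}_{i_n}$ converges in probability to a nonrandom positive semidefinite $L\times L$ matrix of rank $r_n$ (positive definite when $r_n=L$). (iii) $\mathbb E\varepsilon_i=0$ and $\mathbb E\varepsilon_i^8$ is bounded. (iv) $\frac1N\sum_{i,i'}|\mathbb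 E\varepsilon_i\varepsilon_{i'}|$ is bounded. (v) $\varepsilon_i$ is independent of $X_{i'}$ and of $\varphi^{(n)}_{i_n'}$, for all $i,i',n$. (vi) For each $n$, $N_n^{-2}\prod_{n'\ne n}N_{n'}^{-1}\sum|\mathrm{cov}(\varepsilon_{\cdot i_n\cdot}\varepsilon_{\cdot j_n\cdot},\varepsilon_{\cdot k_n\cdot}\varepsilon_{\cdot m_n\cdot})|$ is bounded, where the sum is over $i_n,j_n,k_n,m_n$ and over the remaining indices, which are common to the four factors. 6. (Rates) There are (possibly random) sequences $\xi_X,\xi_\beta,\xi_{\mathcal A}\to0$ in probability with $\xi_X\xi_\beta=o_p(N^{-1/2})$, $\xi_X\xi_{\mathcal A}=o_p(N^{-1/2})$, $(\|\widehat\Gamma_{X_k}-\Gamma_{X_k}\|_F^2/N)^{1/2}=O_p(\xi_X)$ for each $k$, $(\|\widehat{\mathcal A}-\mathcal A\|_F^2/N)^{1/2}=O_p(\xi_{\mathcal A})$, and $\|\beta^0-\widetilde\beta\|=O_p(\xi_\beta)$. 7. (Independence, between whole tensors) For all $k,k'$: $\eta_k$ is independent of the pair $(\mathcal A,\widehat{\mathcal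 A})$; $\eta_k$ is independent of $\widehat\Gamma_{X_{k'}}$; $\varepsilon$ is independent of the pair $(\Gamma_{X_k},\widehat\Gamma_{X_k})$. 8. (Non-singularity) $\mathbb E[\eta_i\eta_i']$ is non-singular and $\mathbb E[\varepsilon_i\mid\eta_i]=0$. 9. (Homoskedasticity) The pairs $(\varepsilon_i,\eta_i)$ are i.i.d. across $i$, with a law that does not depend on the sample size, and $\mathbb E(\varepsilon_i^2\mid\eta_i)=\mathbb E(\varepsilon_i^2)=\sigma_\varepsilon^2<\infty$. *Conclusion.* If $N_n\to\infty$ and $N_n\lesssim\prod_{n'\ne n}N_{n'}$ for every $n=1,\dots,d$, then $$\Omega_X:=\operatorname*{plim}\frac1N\sum_i\eta_i\eta_i'$$ exists and is positive definite, and $$\sqrt N\,(\widehat\beta_{IC}-\beta^0)\ \xrightarrow{d}\ \mathcal N\big(0,\ \sigma_\varepsilon^2\,\Omega_X^{-1}\big).$$ -/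

import Mathlib

open MeasureTheory ProbabilityTheory Filter Topology Asymptotics

noncomputable section

namespace TensorPanel

/-! ### Stochastic order symbols along a sequence of samples -/

section Order

variable {Ω : Type*} [MeasurableSpace Ω]

/-- `Y m = O_p(r m)`; the rate `r` may itself be random. -/
def IsBigOp (μ : Measure Ω) (Y r : ℕ → Ω → ℝ) : Prop :=
  ∀ δ : ℝ, 0 < δ → ∃ M : ℝ, ∀ᶠ m in atTop,
    μ {ω | M * |r m ω| < |Y m ω|} ≤ ENNReal.ofReal δ

/-- `Y m = o_p(r m)`; the rate `r` may itself be random. -/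
def IsLittleOp (μ : Measure Ω) (Y r : ℕ → Ω → ℝ) : Prop :=
  ∀ c : ℝ, 0 < c → Tendsto (fun m => μ {ω | c * |r m ω| < |Y m ω|}) atTop (𝓝 0)

/-- The events `{ω | p m ω}` hold with probability approaching one. -/
def Wpa1 (μ : Measure Ω) (p : ℕ → Ω → Prop) : Prop :=
  Tendsto (fun m => μ {ω | p m ω}) atTop (𝓝 1)

end Order

/-! ### Tensors of order `d` with dimensions `N 0, …, N (d-1)` -/

/-- Multi-indices `(i_1, …, i_d)`. -/
abbrev Idx {d : ℕ} (N : Fin d → ℕ) : Type := ∀ n : Fin d, Fin (N n)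

/-- The mode-`n` flattening: mode `n` along the rows, all other modes along the columns. -/
def flatten {d : ℕ} {N : Fin d → ℕ} (n : Fin d) (T : Idx N → ℝ) :
    Matrix (Fin (N n)) (∀ n' : {n' : Fin d // n' ≠ n}, Fin (N n')) ℝ :=
  Matrix.of fun a c => T ((Equiv.piSplitAt n (fun n' => Fin (N n'))).symm (a, c))

/-- The `n`-th component of the multilinear rank. -/
def mrank {d : ℕ} {N : Fin d → ℕ} (n : Fin d) (T : Idx N → ℝ) : ℕ := (flatten n T).rank

/-- `T ×_1 M_1 ×_2 M_2 … ×_d M_d`, the successive `n`-mode products in closed form. -/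
def multiModeProd {d : ℕ} {N : Fin d → ℕ} (M : ∀ n : Fin d, Matrix (Fin (N n)) (Fin (N n)) ℝ)
    (T : Idx N → ℝ) : Idx N → ℝ :=
  fun i => ∑ j : Idx N, (∏ n, M n (i n) (j n)) * T j

/-- The kernel weight matrix built from proxies `p` with kernel `k` and bandwidth `h`. -/
def kernelWeights {L n : ℕ} (k : ℝ → ℝ) (h : ℝ) (p : Fin n → EuclideanSpace ℝ (Fin L)) :
    Matrix (Fin n) (Fin n) ℝ :=
  Matrix.of fun i j => k (‖p i - p j‖ / h) / ∑ j', k (‖p i - p j'‖ / h)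

/-! ### The data, the unknown quantities, and the preliminary estimates -/

/-- A sequence (indexed by `m`) of samples from the `d`-dimensional panel model with `K`
covariates and `L` interactive terms: sample sizes, slope, fixed-effect vectors
`φ^{(n)}_{i_n} ∈ ℝ^L`, covariates, noise, the proxies, kernel and bandwidths of the kernel
weights, and the preliminary estimates of `E(X | 𝒜)`, `𝒜` and `β⁰`.  The only laws are
measurability. -/
structure Panel (Ω : Type*) [MeasurableSpace Ω] (d K L : ℕ) where
  N : ℕ → Fin d → ℕ
  beta0 : EuclideanSpace ℝ (Fin K)
  phi : ∀ (m : ℕ) (n : Fin d), Fin (N m n) → Ω → EuclideanSpace ℝ (Fin L)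
  X : ∀ m : ℕ, Idx (N m) → Ω → EuclideanSpace ℝ (Fin K)
  eps : ∀ m : ℕ, Idx (N m) → Ω → ℝ
  phiHat : ∀ (m : ℕ) (n : Fin d), Fin (N m n) → Ω → EuclideanSpace ℝ (Fin L)
  ker : ℝ → ℝ
  h : ℕ → Fin d → ℝ
  GammaHat : ∀ m : ℕ, Idx (N m) → Ω → EuclideanSpace ℝ (Fin K)
  AHat : ∀ m : ℕ, Idx (N m) → Ω → ℝ
  betaTilde : ℕ → Ω → EuclideanSpace ℝ (Fin K)
  measurable_phi : ∀ m n i, Measurable (phi m n i)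
  measurable_X : ∀ m i, Measurable (X m i)
  measurable_eps : ∀ m i, Measurable (eps m i)
  measurable_phiHat : ∀ m n i, Measurable (phiHat m n i)
  measurable_GammaHat : ∀ m i, Measurable (GammaHat m i)
  measurable_AHat : ∀ m i, Measurable (AHat m i)
  measurable_betaTilde : ∀ m, Measurable (betaTilde m)

namespace Panel

variable {Ω : Type*} [MeasurableSpace Ω] {d K L : ℕ} (P : Panel Ω d K L)

/-- The total sample size `N = ∏_n N_n`. -/
def size (m : ℕ) : ℝ := ∏ n, (P.N m n : ℝ)

/-- `𝒜 = ∑_ℓ φ_ℓ^{(1)} ∘ ⋯ ∘ φ_ℓ^{(d)}`. -/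
def A (m : ℕ) (i : Idx (P.N m)) (ω : Ω) : ℝ := ∑ l : Fin L, ∏ n, P.phi m n (i n) ω l

/-- `Y = ∑_k X_k β_k⁰ + 𝒜 + ε`. -/
def Y (m : ℕ) (i : Idx (P.N m)) (ω : Ω) : ℝ :=
  (∑ k, P.X m i ω k * P.beta0 k) + P.A m i ω + P.eps m i ω

/-- The σ-algebra generated by the whole tensor `𝒜`. -/
abbrev sigmaA (m : ℕ) : MeasurableSpace Ω :=
  MeasurableSpace.comap (fun ω (i : Idx (P.N m)) => P.A m i ω) inferInstance

/-- `Γ_X = E(X | 𝒜)`. -/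
def Gamma (μ : Measure Ω) (m : ℕ) (i : Idx (P.N m)) : Ω → EuclideanSpace ℝ (Fin K) :=
  μ[P.X m i | P.sigmaA m]

/-- `η = X - Γ_X`. -/
def eta (μ : Measure Ω) (m : ℕ) (i : Idx (P.N m)) (ω : Ω) : EuclideanSpace ℝ (Fin K) :=
  P.X m i ω - P.Gamma μ m i ω

/-- `η̂ = X - Γ̂_X`. -/
def etaHat (m : ℕ) (i : Idx (P.N m)) (ω : Ω) : EuclideanSpace ℝ (Fin K) :=
  P.X m i ω - P.GammaHat m i ω

/-- `Γ̂_Y = Γ̂_X · β̃ + 𝒜̂`. -/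
def GammaYHat (m : ℕ) (i : Idx (P.N m)) (ω : Ω) : ℝ :=
  (∑ k, P.GammaHat m i ω k * P.betaTilde m ω k) + P.AHat m i ω

/-- `Ω̂_X = N⁻¹ vec_K(η̂)' vec_K(η̂)`. -/
def OmegaHat (m : ℕ) (ω : Ω) : Matrix (Fin K) (Fin K) ℝ :=
  Matrix.of fun k l => (P.size m)⁻¹ * ∑ i, P.etaHat m i ω k * P.etaHat m i ω l

/-- The inference-corrected estimator `β̂_IC = Ω̂_X⁻¹ N⁻¹ vec_K(η̂)' vec(Y - Γ̂_Y)`. -/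
def betaIC (m : ℕ) (ω : Ω) : EuclideanSpace ℝ (Fin K) :=
  WithLp.toLp 2 ((P.OmegaHat m ω)⁻¹.mulVec fun k =>
    (P.size m)⁻¹ * ∑ i, P.etaHat m i ω k * (P.Y m i ω - P.GammaYHat m i ω))

/-- The weighted-within transformed covariate `X̌_k = X_k ×_1 (I - W_1) … ×_d (I - W_d)`. -/
def XCheck (m : ℕ) (k : Fin K) (i : Idx (P.N m)) (ω : Ω) : ℝ :=
  multiModeProd (fun n => 1 - kernelWeights P.ker (P.h m n) (fun j => P.phiHat m n j ω))
    (fun j => P.X m j ω k) i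

/-! ### Assumptions -/

/-- Kernel conditions.  "Non-increasing" means non-increasing in `|u|`. -/
structure KernelCond : Prop where
  nonneg : ∀ u, 0 ≤ P.ker u
  nonincreasing : ∀ u v, |u| ≤ |v| → P.ker v ≤ P.ker u
  integrable : Integrable P.ker
  integral_eq_one : ∫ u, P.ker u = 1
  second_moment : Integrable fun u => u ^ 2 * P.ker u
  decay : ∃ δ : ℝ, 2 < δ ∧ P.ker =O[atTop] fun u : ℝ => u ^ (-δ)

/-- Regularity of the proxies along the bandwidths `h_n`: on average, neighbourhoods of radius
`h_n e` around the proxies are non-empty with probability approaching one. -/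
structure ProxyCond (μ : Measure Ω) : Prop where
  h_pos : ∀ m n, 0 < P.h m n
  h_tendsto : ∀ n, Tendsto (fun m => P.h m n) atTop (𝓝 0)
  Nh_tendsto : ∀ n, Tendsto (fun m => (P.N m n : ℝ) * P.h m n) atTop atTop
  neighbours : ∀ n, ∀ e : ℝ, 0 < e → Wpa1 μ fun m ω =>
    0 < (P.N m n : ℝ)⁻¹ * ∑ i : Fin (P.N m n), ∑ i' ∈ Finset.univ.erase i,
      (Metric.ball (P.phiHat m n i ω) (P.h m n * e)).indicator (fun _ => (1 : ℝ))
        (P.phiHat m n i' ω)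

/-- Regularity after the kernel weighted fixed effects are differenced out. -/
structure WithinCond (μ : Measure Ω) : Prop where
  second_moment : ∃ Q : Matrix (Fin K) (Fin K) ℝ, Q.PosDef ∧ ∀ k l,
    TendstoInMeasure μ
      (fun m ω => (P.size m)⁻¹ * ∑ i, P.XCheck m k i ω * P.XCheck m l i ω) atTop
      (fun _ => Q k l)
  exog : ∀ k, IsBigOp μ (fun m ω => (P.size m)⁻¹ * ∑ i, P.XCheck m k i ω * P.eps m i ω)
    (fun m _ => (Real.sqrt (P.size m))⁻¹)

/-- `N_n⁻¹ ∑_{i_n} ‖φ_{i_n}^{(n)} - φ̂_{i_n}^{(n)}‖²`. -/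
def proxyError (n : Fin d) (m : ℕ) (ω : Ω) : ℝ :=
  (P.N m n : ℝ)⁻¹ * ∑ i : Fin (P.N m n), ‖P.phi m n i ω - P.phiHat m n i ω‖ ^ 2

/-- Consistency rates of the proxies: rate `C_n⁻²` in the dimensions of the non-empty set `S`,
boundedness in the others. -/
structure ProxyRate (μ : Measure Ω) (S : Finset (Fin d)) (C : ℕ → Fin d → ℝ) : Prop where
  nonempty : S.Nonempty
  C_pos : ∀ n ∈ S, ∀ m, 0 < C m n
  C_tendsto : ∀ n ∈ S, Tendsto (fun m => (C m n ^ 2)⁻¹) atTop (𝓝 0)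
  rate : ∀ n ∈ S, IsBigOp μ (P.proxyError n) fun m _ => (C m n ^ 2)⁻¹
  bounded : ∀ n ∉ S, IsBigOp μ (P.proxyError n) fun _ _ => 1

/-- Moment, factor and weak-dependence conditions of Bai's type; `r n` is the `n`-th component of
the multilinear rank of `𝒜`. -/
structure BaiCond (μ : Measure Ω) (r : Fin d → ℕ) : Prop where
  X_moment : ∃ B : ℝ, ∀ m i, Integrable (fun ω => ‖P.X m i ω‖ ^ 4) μ ∧
    ∫ ω, ‖P.X m i ω‖ ^ 4 ∂μ ≤ B
  phi_moment : ∃ B : ℝ, ∀ m n i, Integrable (fun ω => ‖P.phi m n i ω‖ ^ 4) μ ∧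
    ∫ ω, ‖P.phi m n i ω‖ ^ 4 ∂μ ≤ B
  rank : ∀ n, Wpa1 μ fun m ω => mrank n (fun i => P.A m i ω) = r n
  phi_gram : ∀ n, ∃ Q : Matrix (Fin L) (Fin L) ℝ, Q.PosSemidef ∧ Q.rank = r n ∧ ∀ l l',
    TendstoInMeasure μ
      (fun m ω => (P.N m n : ℝ)⁻¹ * ∑ i, P.phi m n i ω l * P.phi m n i ω l') atTop
      (fun _ => Q l l')
  eps_mean : ∀ m i, ∫ ω, P.eps m i ω ∂μ = 0
  eps_moment : ∃ B : ℝ, ∀ m i, Integrable (fun ω => P.eps m i ω ^ 8) μ ∧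
    ∫ ω, P.eps m i ω ^ 8 ∂μ ≤ B
  eps_corr : ∃ B : ℝ, ∀ m,
    (P.size m)⁻¹ * ∑ i, ∑ j, |∫ ω, P.eps m i ω * P.eps m j ω ∂μ| ≤ B
  eps_indep_X : ∀ m i j, IndepFun (P.eps m i) (P.X m j) μ
  eps_indep_phi : ∀ m i n j, IndepFun (P.eps m i) (P.phi m n j) μ
  /- `i` carries both `i_n` and the indices in the other dimensions; `j, a, b` replace `i_n`. -/
  eps_cov : ∃ B : ℝ, ∀ m n,
    ((P.N m n : ℝ) ^ 2)⁻¹ * (∏ n' ∈ Finset.univ.erase n, (P.N m n' : ℝ))⁻¹ *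
      (∑ i : Idx (P.N m), ∑ j : Fin (P.N m n), ∑ a : Fin (P.N m n), ∑ b : Fin (P.N m n),
        |cov[fun ω => P.eps m i ω * P.eps m (Function.update i n j) ω,
            fun ω => P.eps m (Function.update i n a) ω * P.eps m (Function.update i n b) ω; μ]|)
      ≤ B

/-- Rates of the preliminary estimates. -/
structure RateCond (μ : Measure Ω) (xiX xiB xiA : ℕ → Ω → ℝ) : Prop where
  xiX_tendsto : IsLittleOp μ xiX fun _ _ => 1
  xiB_tendsto : IsLittleOp μ xiB fun _ _ => 1
  xiA_tendsto : IsLittleOp μ xiA fun _ _ => 1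
  xiX_xiB : IsLittleOp μ (fun m ω => xiX m ω * xiB m ω) fun m _ => (Real.sqrt (P.size m))⁻¹
  xiX_xiA : IsLittleOp μ (fun m ω => xiX m ω * xiA m ω) fun m _ => (Real.sqrt (P.size m))⁻¹
  Gamma_rate : ∀ k, IsBigOp μ
    (fun m ω => Real.sqrt ((∑ i, (P.GammaHat m i ω k - P.Gamma μ m i ω k) ^ 2) / P.size m)) xiX
  A_rate : IsBigOp μ
    (fun m ω => Real.sqrt ((∑ i, (P.AHat m i ω - P.A m i ω) ^ 2) / P.size m)) xiA
  beta_rate : IsBigOp μ (fun m ω => ‖P.beta0 - P.betaTilde m ω‖) xiB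

/-- Independence of the tensors `η_k` and `ε` from the preliminary estimates. -/
structure IndepCond (μ : Measure Ω) : Prop where
  eta_A : ∀ m k, IndepFun (fun ω (i : Idx (P.N m)) => P.eta μ m i ω k)
    (fun ω => ((fun i : Idx (P.N m) => P.A m i ω), fun i : Idx (P.N m) => P.AHat m i ω)) μ
  eta_Gamma : ∀ m k k', IndepFun (fun ω (i : Idx (P.N m)) => P.eta μ m i ω k)
    (fun ω (i : Idx (P.N m)) => P.GammaHat m i ω k') μ
  eps_Gamma : ∀ m k, IndepFun (fun ω (i : Idx (P.N m)) => P.eps m i ω)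
    (fun ω => ((fun i : Idx (P.N m) => P.Gamma μ m i ω k),
      fun i : Idx (P.N m) => P.GammaHat m i ω k)) μ

/-- Non-singularity of `E(ηη')` and conditional mean-zero noise. -/
structure NonsingCond (μ : Measure Ω) : Prop where
  nonsing : ∀ m i, IsUnit
    (Matrix.of fun k l : Fin K => ∫ ω, P.eta μ m i ω k * P.eta μ m i ω l ∂μ)
  eps_cond_mean : ∀ m i,
    μ[P.eps m i | MeasurableSpace.comap (P.eta μ m i) inferInstance] =ᵐ[μ] fun _ => 0

/-- The pairs `(ε_i, η_i)` are i.i.d. across `i` (with one common law for all sample sizes), and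
`ε` is conditionally homoskedastic with variance `s2`. -/
structure HomoskedCond (μ : Measure Ω) (s2 : ℝ) : Prop where
  indep : ∀ m, iIndepFun (fun (i : Idx (P.N m)) ω => (P.eps m i ω, P.eta μ m i ω)) μ
  ident : ∀ m m' i j, IdentDistrib (fun ω => (P.eps m i ω, P.eta μ m i ω))
    (fun ω => (P.eps m' j ω, P.eta μ m' j ω)) μ μ
  var_eq : ∀ m i, ∫ ω, P.eps m i ω ^ 2 ∂μ = s2
  cond_var : ∀ m i,
    μ[fun ω => P.eps m i ω ^ 2 | MeasurableSpace.comap (P.eta μ m i) inferInstance]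
      =ᵐ[μ] fun _ => s2

/-- Every `N_n → ∞`, with `N_n ≲ ∏_{n' ≠ n} N_{n'}`. -/
structure Growth : Prop where
  tendsto : ∀ n, Tendsto (fun m => P.N m n) atTop atTop
  comparable : ∀ n, (fun m => (P.N m n : ℝ)) =O[atTop]
    fun m => ∏ n' ∈ Finset.univ.erase n, (P.N m n' : ℝ)

end Panel

end TensorPanel

end

/-!
Write `D = Γ_X - Γ̂_X`, so that `η̂ = η + D`. At the true slope the residual `Y - Γ̂_Y - η̂'β⁰`
equals `ε + (𝒜 - 𝒜̂) + Γ̂_X'(β⁰ - β̃)`, and therefore, wherever `Ω̂_X` is invertible,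
`√N (β̂_IC - β⁰) = Ω̂_X⁻¹ (N^{-1/2} ∑ ε_i η_i + R)`. The remainder `R` has two kinds of terms.

* A product of two estimation errors, `D` with `𝒜 - 𝒜̂` or with `Γ̂_X'(β⁰ - β̃)`, is bounded by
  the Cauchy–Schwarz inequality and is negligible because `ξ_X ξ_𝒜` and `ξ_X ξ_β` are
  `o_p(N^{-1/2})`.
* A sum of `ε_i D_i`, of `η_i (𝒜_i - 𝒜̂_i)` or of `η_i Γ̂_{X,i}` pairs centred uncorrelated noise
  with random weights independent of the noise. By `isBigOp_sum_mul_of_indepFun`, such a sum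
  divided by `√N` is of the order of the root mean square of the weights, which is `o_p(1)` in the
  first two cases and `O_p(1)`, multiplied by `β⁰ - β̃ = o_p(1)`, in the third.

Since `X` has four moments, so has `η`; hence `N⁻¹ ∑ η_i η_i'`, and with it `Ω̂_X`, converges in
probability to `Ω_X = E(η_i η_i')` by Chebyshev's inequality. The limit is positive definite, being
a non-singular second-moment matrix. This makes the estimator asymptotically linear
(`Panel.isLittleOp_betaIC_sub_leading`) with leading term `N^{-1/2} ∑ ε_i Ω_X⁻¹ η_i`. Its summands
form an array with i.i.d. rows and a law common to all rows, so the Lévy continuity theorem applies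
(`tendstoInDistribution_sum_array`). Homoskedasticity turns the covariance
`Ω_X⁻¹ E(ε² η η') Ω_X⁻¹` into `σ² Ω_X⁻¹`.
-/

namespace TensorPanel

/-! ### Calculus of stochastic orders -/

section OrderCalculus

variable {Ω : Type*} [MeasurableSpace Ω] {μ : Measure Ω} {Y Z r s : ℕ → Ω → ℝ}

lemma IsBigOp.refl (Y : ℕ → Ω → ℝ) : IsBigOp μ Y Y := fun δ _ =>
  ⟨1, Eventually.of_forall fun m => by simp⟩

lemma IsBigOp.mono (hZ : IsBigOp μ Z r) (h : ∀ m ω, |Y m ω| ≤ |Z m ω|) : IsBigOp μ Y r := by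
  intro δ hδ
  obtain ⟨M, hM⟩ := hZ δ hδ
  refine ⟨M, hM.mono fun m hm => (measure_mono fun ω hω => ?_).trans hm⟩
  exact lt_of_lt_of_le hω (h m ω)

lemma IsLittleOp.mono (hZ : IsLittleOp μ Z r) (h : ∀ m ω, |Y m ω| ≤ |Z m ω|) :
    IsLittleOp μ Y r := by
  intro c hc
  refine tendsto_of_tendsto_of_tendsto_of_le_of_le tendsto_const_nhds (hZ c hc)
    (fun _ => zero_le) fun m => measure_mono fun ω hω => ?_
  exact lt_of_lt_of_le hω (h m ω)

lemma IsBigOp.mul {Y' r' : ℕ → Ω → ℝ} (h : IsBigOp μ Y r) (h' : IsBigOp μ Y' r') :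
    IsBigOp μ (fun m ω => Y m ω * Y' m ω) (fun m ω => r m ω * r' m ω) := by
  intro δ hδ
  obtain ⟨M, hM⟩ := h (δ / 2) (half_pos hδ)
  obtain ⟨M', hM'⟩ := h' (δ / 2) (half_pos hδ)
  refine ⟨|M| * |M'|, ?_⟩
  filter_upwards [hM, hM'] with m hm hm'
  calc μ {ω | |M| * |M'| * |r m ω * r' m ω| < |Y m ω * Y' m ω|}
      ≤ μ ({ω | M * |r m ω| < |Y m ω|} ∪ {ω | M' * |r' m ω| < |Y' m ω|}) := by
        refine measure_mono fun ω hω => ?_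
        by_contra hcon
        simp only [Set.mem_union, Set.mem_ofPred_eq, not_or, not_lt] at hcon hω
        refine absurd hω (not_lt.2 ?_)
        rw [abs_mul, abs_mul]
        calc |Y m ω| * |Y' m ω| ≤ (|M| * |r m ω|) * (|M'| * |r' m ω|) := by
              gcongr
              · exact hcon.1.trans (by gcongr; exact le_abs_self M)
              · exact hcon.2.trans (by gcongr; exact le_abs_self M')
          _ = _ := by ring
    _ ≤ ENNReal.ofReal (δ / 2) + ENNReal.ofReal (δ / 2) :=
        (measure_union_le _ _).trans (add_le_add hm hm')
    _ = ENNReal.ofReal δ := by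
        rw [← ENNReal.ofReal_add (half_pos hδ).le (half_pos hδ).le, add_halves]

/-- `O_p(r)` is `o_p(s)` when `r = o_p(s)`. -/
lemma IsBigOp.trans_isLittleOp (h : IsBigOp μ Y r) (hr : IsLittleOp μ r s) :
    IsLittleOp μ Y s := by
  intro c hc
  rw [ENNReal.tendsto_nhds_zero]
  intro e he
  obtain ⟨δ, hδ, hδe⟩ : ∃ δ : ℝ, 0 < δ ∧ ENNReal.ofReal δ + ENNReal.ofReal δ ≤ e := by
    rcases eq_or_ne e ⊤ with rfl | hetop
    · exact ⟨1, one_pos, le_top⟩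
    · have hpos := ENNReal.toReal_pos he.ne' hetop
      refine ⟨e.toReal / 2, half_pos hpos, ?_⟩
      rw [← ENNReal.ofReal_add (half_pos hpos).le (half_pos hpos).le, add_halves,
        ENNReal.ofReal_toReal hetop]
  obtain ⟨M, hM⟩ := h δ hδ
  have hM0 : 0 < |M| + 1 := by positivity
  have h2 := (ENNReal.tendsto_nhds_zero.1 (hr (c / (|M| + 1)) (by positivity)))
    (ENNReal.ofReal δ) (ENNReal.ofReal_pos.2 hδ)
  filter_upwards [hM, h2] with m hm hm2
  refine le_trans (measure_mono (t := {ω | M * |r m ω| < |Y m ω|} ∪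
    {ω | c / (|M| + 1) * |s m ω| < |r m ω|}) fun ω hω => ?_)
    ((measure_union_le _ _).trans ((add_le_add hm hm2).trans hδe))
  by_contra hcon
  simp only [Set.mem_union, Set.mem_ofPred_eq, not_or, not_lt] at hcon hω
  refine absurd hω (not_lt.2 ?_)
  calc |Y m ω| ≤ M * |r m ω| := hcon.1
    _ ≤ (|M| + 1) * |r m ω| := by
        gcongr
        linarith [le_abs_self M]
    _ ≤ (|M| + 1) * (c / (|M| + 1) * |s m ω|) := by gcongr; exact hcon.2
    _ = c * |s m ω| := by field_simp

lemma IsBigOp.mul_isLittleOp (h : IsBigOp μ Y fun _ _ => 1) (hZ : IsLittleOp μ Z s) :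
    IsLittleOp μ (fun m ω => Y m ω * Z m ω) s := by
  have := h.mul (IsBigOp.refl (μ := μ) Z)
  simp only [one_mul] at this
  exact this.trans_isLittleOp hZ

lemma IsLittleOp.add (h : IsLittleOp μ Y r) (h' : IsLittleOp μ Z r) :
    IsLittleOp μ (fun m ω => Y m ω + Z m ω) r := by
  intro c hc
  have hsum := (h (c / 2) (half_pos hc)).add (h' (c / 2) (half_pos hc))
  rw [add_zero] at hsum
  refine tendsto_of_tendsto_of_tendsto_of_le_of_le tendsto_const_nhds hsum
    (fun _ => zero_le) fun m => (measure_mono fun ω hω => ?_).trans (measure_union_le _ _)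
  by_contra hcon
  simp only [Set.mem_union, Set.mem_ofPred_eq, not_or, not_lt] at hcon hω
  linarith [abs_add_le (Y m ω) (Z m ω)]

lemma isLittleOp_zero : IsLittleOp μ (fun _ _ => 0) r := by
  intro c hc
  have : ∀ m, μ {ω | c * |r m ω| < |(0 : ℝ)|} = 0 := fun m => by
    convert measure_empty (μ := μ)
    ext ω
    simpa using mul_nonneg hc.le (abs_nonneg _)
  simp only [this, tendsto_const_nhds]

lemma IsLittleOp.sum {ι : Type*} (t : Finset ι) {Y : ι → ℕ → Ω → ℝ}
    (h : ∀ i ∈ t, IsLittleOp μ (Y i) r) :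
    IsLittleOp μ (fun m ω => ∑ i ∈ t, Y i m ω) r := by
  classical
  induction t using Finset.induction_on with
  | empty => simpa using isLittleOp_zero
  | insert a t ha ih =>
    simp only [Finset.sum_insert ha]
    exact (h a (by simp)).add (ih fun i hi => h i (by simp [hi]))

lemma IsBigOp.add (h : IsBigOp μ Y fun _ _ => 1) (h' : IsBigOp μ Z fun _ _ => 1) :
    IsBigOp μ (fun m ω => Y m ω + Z m ω) fun _ _ => 1 := by
  intro δ hδ
  obtain ⟨M, hM⟩ := h (δ / 2) (half_pos hδ)
  obtain ⟨M', hM'⟩ := h' (δ / 2) (half_pos hδ)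
  refine ⟨M + M', ?_⟩
  filter_upwards [hM, hM'] with m hm hm'
  rw [← add_halves δ, ENNReal.ofReal_add (half_pos hδ).le (half_pos hδ).le]
  refine (measure_mono fun ω hω => ?_).trans
    ((measure_union_le _ _).trans (add_le_add hm hm'))
  by_contra hcon
  simp only [Set.mem_union, Set.mem_ofPred_eq, not_or, not_lt, abs_one, mul_one] at hcon hω
  linarith [abs_add_le (Y m ω) (Z m ω)]

lemma IsLittleOp.isBigOp (h : IsLittleOp μ Y r) : IsBigOp μ Y r := fun _ hδ =>
  ⟨1, ENNReal.tendsto_nhds_zero.1 (h 1 one_pos) _ (ENNReal.ofReal_pos.2 hδ)⟩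

/-- An `o_p(N^{-1/2})` term is `o_p(1)` after multiplication by `√N`; no positivity of `N` is
needed, since `√N * Y` vanishes when `√N = 0`. -/
lemma IsLittleOp.sqrt_mul {N : ℕ → ℝ} (h : IsLittleOp μ Y fun m _ => (√(N m))⁻¹) :
    IsLittleOp μ (fun m ω => √(N m) * Y m ω) fun _ _ => 1 := by
  intro c hc
  refine tendsto_of_tendsto_of_tendsto_of_le_of_le tendsto_const_nhds (h c hc)
    (fun _ => zero_le) fun m => measure_mono fun ω hω => ?_
  simp only [Set.mem_ofPred_eq, abs_one, mul_one, abs_mul, abs_inv] at hω ⊢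
  rcases (abs_nonneg (√(N m))).eq_or_lt with h0 | h0
  · rw [← h0, zero_mul] at hω
    exact absurd hω hc.le.not_gt
  · rwa [← div_eq_mul_inv, div_lt_iff₀' h0]

lemma isLittleOp_const_of_tendsto {a : ℕ → ℝ} (ha : Tendsto a atTop (𝓝 0)) :
    IsLittleOp μ (fun m _ => a m) fun _ _ => 1 := by
  intro c hc
  refine tendsto_const_nhds.congr' ?_
  filter_upwards [ha.abs.eventually (gt_mem_nhds (by simpa using hc : |(0 : ℝ)| < c))] with m hm
  symm
  convert measure_empty (μ := μ)
  ext ω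
  simpa using hm.le

lemma isBigOp_const (a : ℝ) : IsBigOp μ (fun _ _ => a) fun _ _ => 1 := fun _ _ =>
  ⟨|a|, Eventually.of_forall fun m => by simp⟩

lemma IsBigOp.const_mul (h : IsBigOp μ Y fun _ _ => 1) (a : ℝ) :
    IsBigOp μ (fun m ω => a * Y m ω) fun _ _ => 1 := by
  simpa only [mul_one] using (isBigOp_const a).mul h

/-- Markov's inequality: uniformly bounded second moments give `O_p(1)`. -/
lemma isBigOp_one_of_sq_integral_le {B : ℝ} (hint : ∀ m, Integrable (fun ω => Y m ω ^ 2) μ)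
    (hB : ∀ m, ∫ ω, Y m ω ^ 2 ∂μ ≤ B) [IsFiniteMeasure μ] : IsBigOp μ Y fun _ _ => 1 := by
  intro δ hδ
  have hB0 : 0 ≤ B := (integral_nonneg fun ω => sq_nonneg (Y 0 ω)).trans (hB 0)
  refine ⟨√(B / δ + 1), Eventually.of_forall fun m => ?_⟩
  have hM : 0 < B / δ + 1 := by positivity
  have hmarkov := mul_meas_ge_le_integral_of_nonneg
    (ae_of_all μ fun ω => sq_nonneg (Y m ω)) (hint m) (B / δ + 1)
  have hsub : μ {ω | √(B / δ + 1) * |(1 : ℝ)| < |Y m ω|} ≤ μ {ω | B / δ + 1 ≤ Y m ω ^ 2} := by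
    refine measure_mono fun ω hω => ?_
    simp only [Set.mem_ofPred_eq, abs_one, mul_one] at hω ⊢
    rw [← sq_abs]
    exact (Real.lt_sq_of_sqrt_lt hω).le
  refine hsub.trans ?_
  rw [← ENNReal.ofReal_toReal (measure_ne_top μ {ω | B / δ + 1 ≤ Y m ω ^ 2})]
  refine ENNReal.ofReal_le_ofReal ?_
  have h1 : (B / δ + 1) * (μ {ω | B / δ + 1 ≤ Y m ω ^ 2}).toReal ≤ B := hmarkov.trans (hB m)
  have h2 : B ≤ (B / δ + 1) * δ := by
    have : (B / δ + 1) * δ = B + δ := by field_simp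
    linarith
  exact le_of_mul_le_mul_left (h1.trans h2) hM

lemma IsLittleOp.congr_of_tendsto (hZ : IsLittleOp μ Z r)
    (h : Tendsto (fun m => μ {ω | Y m ω ≠ Z m ω}) atTop (𝓝 0)) : IsLittleOp μ Y r := by
  intro c hc
  have hsum := (hZ c hc).add h
  rw [add_zero] at hsum
  refine tendsto_of_tendsto_of_tendsto_of_le_of_le tendsto_const_nhds hsum
    (fun _ => zero_le) fun m => (measure_mono fun ω hω => ?_).trans (measure_union_le _ _)
  by_contra hcon
  simp only [Set.mem_union, Set.mem_ofPred_eq, not_or, not_not] at hcon hω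
  exact hcon.1 (hcon.2 ▸ hω)

lemma tendstoInMeasure_of_isLittleOp {E : Type*} [SeminormedAddCommGroup E] {f : ℕ → Ω → E}
    {g : Ω → E} (h : IsLittleOp μ (fun m ω => ‖f m ω - g ω‖) fun _ _ => 1) :
    TendstoInMeasure μ f atTop g := by
  rw [tendstoInMeasure_iff_norm]
  intro e he
  refine tendsto_of_tendsto_of_tendsto_of_le_of_le tendsto_const_nhds (h (e / 2) (half_pos he))
    (fun _ => zero_le) fun m => measure_mono fun ω hω => ?_
  simp only [Set.mem_ofPred_eq, abs_one, mul_one, abs_norm] at hω ⊢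
  linarith

/-- If the entries of random arrays converge in probability to those of `A₀`, the arrays lie
in any given neighbourhood of `A₀` with probability approaching one. -/
lemma tendsto_measure_notMem_nhds {κ κ' : Type*} [Finite κ] [Finite κ']
    {A : ℕ → Ω → κ → κ' → ℝ}
    {A₀ : κ → κ' → ℝ}
    (h : ∀ k l, IsLittleOp μ (fun m ω => A m ω k l - A₀ k l) fun _ _ => 1)
    {U : Set (κ → κ' → ℝ)} (hU : U ∈ 𝓝 A₀) :
    Tendsto (fun m => μ {ω | A m ω ∉ U}) atTop (𝓝 0) := by
  have := Fintype.ofFinite κ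
  have := Fintype.ofFinite κ'
  obtain ⟨e, he, heU⟩ : ∃ e : ℝ, 0 < e ∧ ∀ B : κ → κ' → ℝ,
      (∀ k l, |B k l - A₀ k l| ≤ e) → B ∈ U := by
    obtain ⟨e, he, hball⟩ := Metric.nhds_basis_closedBall.mem_iff.1 hU
    refine ⟨e, he, fun B hB => hball ?_⟩
    rw [Metric.mem_closedBall, dist_pi_le_iff he.le]
    intro k
    rw [dist_pi_le_iff he.le]
    exact fun l => (Real.dist_eq _ _).trans_le (hB k l)
  have hsum : Tendsto (fun m => ∑ p : κ × κ', μ {ω | e * |(1 : ℝ)| < |A m ω p.1 p.2 - A₀ p.1 p.2|})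
      atTop (𝓝 0) := by
    simpa using tendsto_finsetSum Finset.univ fun (p : κ × κ') _ => h p.1 p.2 e he
  refine tendsto_of_tendsto_of_tendsto_of_le_of_le tendsto_const_nhds hsum
    (fun _ => zero_le) fun m => ?_
  refine (measure_mono fun ω hω => ?_).trans (measure_iUnion_fintype_le μ _)
  by_contra hcon
  simp only [Set.mem_iUnion, Set.mem_ofPred_eq, not_exists, not_lt, abs_one, mul_one] at hcon hω
  exact hω (heU _ fun k l => hcon (k, l))

end OrderCalculus

/-! ### Weighted sums of uncorrelated noise -/

section Noise

variable {Ω : Type*} [MeasurableSpace Ω] {μ : Measure Ω}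

/-- For centred uncorrelated `u i` with variances at most `B`, independent of the weights `f i`,
and `∑ f i ^ 2 ≤ 1`, the weighted sum `∑ u i * f i` has second moment at most `B`. -/
lemma integral_sq_sum_mul_le [IsProbabilityMeasure μ] {ι : Type*} [Fintype ι]
    {u f : ι → Ω → ℝ} {B : ℝ} (hB : 0 ≤ B)
    (hu : ∀ i, MemLp (u i) 2 μ) (hf : ∀ i, Measurable (f i))
    (hvar : ∀ i, ∫ ω, u i ω ^ 2 ∂μ ≤ B)
    (hcov : ∀ i j, i ≠ j → ∫ ω, u i ω * u j ω ∂μ = 0)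
    (hindep : ∀ i j, IndepFun (fun ω => u i ω * u j ω) (fun ω => f i ω * f j ω) μ)
    (hf1 : ∀ ω, ∑ i, f i ω ^ 2 ≤ 1) :
    Integrable (fun ω => (∑ i, u i ω * f i ω) ^ 2) μ ∧
      ∫ ω, (∑ i, u i ω * f i ω) ^ 2 ∂μ ≤ B := by
  have hfle : ∀ i ω, |f i ω| ≤ 1 := fun i ω => by
    rw [← sq_le_one_iff_abs_le_one]
    exact (Finset.single_le_sum (f := fun i => f i ω ^ 2) (fun i _ => sq_nonneg _)
      (Finset.mem_univ i)).trans (hf1 ω)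
  have hff : ∀ i j, Integrable (fun ω => f i ω * f j ω) μ := fun i j =>
    Integrable.of_bound ((hf i).mul (hf j)).aestronglyMeasurable 1 (ae_of_all _ fun ω => by
      rw [Real.norm_eq_abs, abs_mul]
      exact mul_le_one₀ (hfle i ω) (abs_nonneg _) (hfle j ω))
  have huu : ∀ i j, Integrable (fun ω => u i ω * u j ω) μ := fun i j =>
    (hu i).integrable_mul (hu j)
  have hall : ∀ i j, Integrable (fun ω => (u i ω * u j ω) * (f i ω * f j ω)) μ := fun i j =>
    (hindep i j).integrable_mul (huu i j) (hff i j)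
  have hexp : ∀ ω, (∑ i, u i ω * f i ω) ^ 2
      = ∑ i, ∑ j, (u i ω * u j ω) * (f i ω * f j ω) := fun ω => by
    rw [sq, Finset.sum_mul_sum]
    exact Finset.sum_congr rfl fun i _ => Finset.sum_congr rfl fun j _ => by ring
  simp only [hexp]
  refine ⟨integrable_finsetSum _ fun i _ => integrable_finsetSum _ fun j _ => hall i j, ?_⟩
  rw [integral_finsetSum _ fun i _ => integrable_finsetSum _ fun j _ => hall i j]
  have hrow : ∀ i, ∫ ω, ∑ j, (u i ω * u j ω) * (f i ω * f j ω) ∂μ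
      = (∫ ω, u i ω ^ 2 ∂μ) * ∫ ω, f i ω ^ 2 ∂μ := fun i => by
    rw [integral_finsetSum _ fun j _ => hall i j, Finset.sum_eq_single i]
    · rw [(hindep i i).integral_fun_mul_eq_mul_integral (huu i i).1 (hff i i).1]
      simp only [sq]
    · intro j _ hj
      rw [(hindep i j).integral_fun_mul_eq_mul_integral (huu i j).1 (hff i j).1,
        hcov i j hj.symm, zero_mul]
    · simp
  simp only [hrow]
  calc ∑ i, (∫ ω, u i ω ^ 2 ∂μ) * ∫ ω, f i ω ^ 2 ∂μ
      ≤ ∑ i, B * ∫ ω, f i ω ^ 2 ∂μ := Finset.sum_le_sum fun i _ =>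
        mul_le_mul_of_nonneg_right (hvar i) (integral_nonneg fun ω => sq_nonneg _)
    _ = B * ∫ ω, ∑ i, f i ω ^ 2 ∂μ := by
        rw [integral_finsetSum _ fun i _ => by simpa only [sq] using hff i i, Finset.mul_sum]
    _ ≤ B * 1 := by
        gcongr
        have := integral_mono (μ := μ)
          (integrable_finsetSum Finset.univ fun i _ => by simpa only [sq] using hff i i)
          (integrable_const (1 : ℝ)) hf1
        simpa using this
    _ = B := mul_one B

/-- The root mean square of a tensor, normalised by `N`. -/
noncomputable def rms {ι : Type*} [Fintype ι] (N : ℝ) (w : ι → ℝ) : ℝ := √((∑ i, w i ^ 2) / N)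

/-- `N^{-1/2} ∑ u i * w i` is of the order of the root mean square of the random weights `w`,
when the noise `u` is centred, uncorrelated, of bounded variance, and independent of `w`.
Dividing the weights by their Euclidean norm reduces this to a second-moment bound, so that no
moment of the weights is needed. -/
lemma isBigOp_sum_mul_of_indepFun [IsProbabilityMeasure μ] {ι : ℕ → Type*}
    [∀ m, Fintype (ι m)] {u w : ∀ m, ι m → Ω → ℝ} {B : ℝ} (N : ℕ → ℝ) (hB : 0 ≤ B)
    (hu : ∀ m i, MemLp (u m i) 2 μ) (hw : ∀ m i, Measurable (w m i))
    (hvar : ∀ m i, ∫ ω, u m i ω ^ 2 ∂μ ≤ B)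
    (hcov : ∀ m i j, i ≠ j → ∫ ω, u m i ω * u m j ω ∂μ = 0)
    (hindep : ∀ m, IndepFun (fun ω i => u m i ω) (fun ω i => w m i ω) μ) :
    IsBigOp μ (fun m ω => (√(N m))⁻¹ * ∑ i, u m i ω * w m i ω)
      (fun m ω => rms (N m) fun i => w m i ω) := by
  set q : ℕ → Ω → ℝ := fun m ω => √(∑ i, w m i ω ^ 2) with hq
  have hmom := fun m => integral_sq_sum_mul_le (μ := μ) (u := u m)
    (f := fun i ω => w m i ω / q m ω) hB (hu m)
    (fun i => (hw m i).div (Finset.measurable_sum _ fun j _ => (hw m j).pow_const 2).sqrt)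
    (hvar m) (hcov m)
    (fun i j => (hindep m).comp (φ := fun x : ι m → ℝ => x i * x j)
      (ψ := fun x : ι m → ℝ => x i / √(∑ i, x i ^ 2) * (x j / √(∑ i, x i ^ 2)))
      (by fun_prop) (by fun_prop))
    (fun ω => by
      have h0 : 0 ≤ ∑ i, w m i ω ^ 2 := Finset.sum_nonneg fun i _ => sq_nonneg _
      simp only [div_pow, ← Finset.sum_div, hq, Real.sq_sqrt h0]
      exact div_self_le_one _)
  have hT := isBigOp_one_of_sq_integral_le (fun m => (hmom m).1) (fun m => (hmom m).2)
  have hmul := hT.mul (IsBigOp.refl (μ := μ) fun m ω => rms (N m) fun i => w m i ω)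
  simp only [one_mul] at hmul
  refine hmul.mono fun m ω => le_of_eq (congrArg _ ?_)
  -- Division by a zero norm is harmless: all weights vanish in that case.
  have h0 : 0 ≤ ∑ i, w m i ω ^ 2 := Finset.sum_nonneg fun i _ => sq_nonneg _
  have hcancel : ∀ i, w m i ω / q m ω * q m ω = w m i ω := fun i => by
    refine div_mul_cancel_of_imp fun hz => ?_
    rw [hq, Real.sqrt_eq_zero h0, Finset.sum_eq_zero_iff_of_nonneg fun i _ => sq_nonneg _] at hz
    exact pow_eq_zero_iff two_ne_zero |>.1 (hz i (Finset.mem_univ i))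
  rw [rms, Real.sqrt_div h0, div_eq_mul_inv, ← mul_assoc, mul_comm]
  congr 1
  rw [Finset.sum_mul]
  exact Finset.sum_congr rfl fun i _ => by rw [mul_assoc, hcancel]

/-- Normalised sums of centred uncorrelated noise are stochastically bounded. -/
lemma isBigOp_sum_of_uncorrelated [IsProbabilityMeasure μ] {ι : ℕ → Type*}
    [∀ m, Fintype (ι m)] {u : ∀ m, ι m → Ω → ℝ} {B : ℝ} {N : ℕ → ℝ} (hB : 0 ≤ B)
    (hN : ∀ m, N m = Fintype.card (ι m)) (hu : ∀ m i, MemLp (u m i) 2 μ)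
    (hvar : ∀ m i, ∫ ω, u m i ω ^ 2 ∂μ ≤ B)
    (hcov : ∀ m i j, i ≠ j → ∫ ω, u m i ω * u m j ω ∂μ = 0) :
    IsBigOp μ (fun m ω => (√(N m))⁻¹ * ∑ i, u m i ω) fun _ _ => 1 := by
  have h := isBigOp_sum_mul_of_indepFun (w := fun _ _ _ => 1) N hB hu
    (fun _ _ => measurable_const) hvar hcov (fun m => indepFun_const_right _ _)
  simp only [mul_one] at h
  intro δ hδ
  obtain ⟨M, hM⟩ := h δ hδ
  refine ⟨|M|, hM.mono fun m hm => (measure_mono fun ω hω => ?_).trans hm⟩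
  simp only [Set.mem_ofPred_eq, abs_one, mul_one] at hω ⊢
  refine lt_of_le_of_lt ?_ hω
  have hr : |rms (N m) fun _ : ι m => (1 : ℝ)| ≤ 1 := by
    rw [rms, abs_of_nonneg (Real.sqrt_nonneg _), Real.sqrt_le_one]
    simpa [hN m] using div_self_le_one _
  calc M * |rms (N m) fun _ : ι m => (1 : ℝ)|
      ≤ |M| * |rms (N m) fun _ : ι m => (1 : ℝ)| := by gcongr; exact le_abs_self M
    _ ≤ |M| * 1 := by gcongr
    _ = |M| := mul_one _

lemma rms_nonneg {ι : Type*} [Fintype ι] (N : ℝ) (w : ι → ℝ) : 0 ≤ rms N w := Real.sqrt_nonneg _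

/-- Cauchy–Schwarz inequality for the averaged product. -/
lemma abs_inv_mul_sum_mul_le {ι : Type*} [Fintype ι] {N : ℝ} (hN : 0 ≤ N) (v w : ι → ℝ) :
    |N⁻¹ * ∑ i, v i * w i| ≤ rms N v * rms N w := by
  have hv : 0 ≤ ∑ i, v i ^ 2 := Finset.sum_nonneg fun i _ => sq_nonneg _
  have hw : 0 ≤ ∑ i, w i ^ 2 := Finset.sum_nonneg fun i _ => sq_nonneg _
  rw [rms, rms, ← Real.sqrt_mul (by positivity)]
  refine Real.abs_le_sqrt ?_
  rw [mul_pow, inv_pow, div_mul_div_comm, ← sq, div_eq_inv_mul]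
  gcongr
  exact Finset.sum_mul_sq_le_sq_mul_sq _ _ _

lemma rms_add_le {ι : Type*} [Fintype ι] {N : ℝ} (hN : 0 ≤ N) (v w : ι → ℝ) :
    rms N (fun i => v i + w i) ≤ √2 * (rms N v + rms N w) := by
  have hv : 0 ≤ (∑ i, v i ^ 2) / N := div_nonneg (Finset.sum_nonneg fun i _ => sq_nonneg _) hN
  have hw : 0 ≤ (∑ i, w i ^ 2) / N := div_nonneg (Finset.sum_nonneg fun i _ => sq_nonneg _) hN
  have h1 : (∑ i, (v i + w i) ^ 2) / N ≤ 2 * ((∑ i, v i ^ 2) / N + (∑ i, w i ^ 2) / N) := by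
    rw [← add_div, ← mul_div_assoc, ← Finset.sum_add_distrib, Finset.mul_sum]
    gcongr with i
    nlinarith [sq_nonneg (v i - w i)]
  calc rms N (fun i => v i + w i) ≤ √(2 * ((∑ i, v i ^ 2) / N + (∑ i, w i ^ 2) / N)) :=
        Real.sqrt_le_sqrt h1
    _ = √2 * √((∑ i, v i ^ 2) / N + (∑ i, w i ^ 2) / N) := Real.sqrt_mul (by norm_num) _
    _ ≤ √2 * (rms N v + rms N w) := by
        gcongr
        rw [Real.sqrt_le_iff]
        refine ⟨add_nonneg (rms_nonneg N v) (rms_nonneg N w), ?_⟩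
        have h2 : 0 ≤ rms N v * rms N w := mul_nonneg (rms_nonneg N v) (rms_nonneg N w)
        have h3 : rms N v ^ 2 = (∑ i, v i ^ 2) / N := Real.sq_sqrt hv
        have h4 : rms N w ^ 2 = (∑ i, w i ^ 2) / N := Real.sq_sqrt hw
        linarith [add_sq (rms N v) (rms N w)]

lemma rms_sub_le {ι : Type*} [Fintype ι] {N : ℝ} (hN : 0 ≤ N) (v w : ι → ℝ) :
    rms N (fun i => v i - w i) ≤ √2 * (rms N v + rms N w) := by
  simpa [rms, sub_eq_add_neg] using rms_add_le hN v fun i => -w i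

lemma abs_inv_sqrt_mul_sum_mul_le {ι : Type*} [Fintype ι] {N : ℝ} (hN : 0 ≤ N) (v w : ι → ℝ) :
    |(√N)⁻¹ * ∑ i, v i * w i| ≤ √N * (rms N v * rms N w) := by
  have h : (√N)⁻¹ = √N * N⁻¹ := by
    rw [← Real.sqrt_div_self, div_eq_mul_inv]
  rw [h, mul_assoc, abs_mul, abs_of_nonneg (Real.sqrt_nonneg N)]
  gcongr
  exact abs_inv_mul_sum_mul_le hN v w

/-- Root mean squares of entries with uniformly bounded second moments are stochastically
bounded. -/
lemma isBigOp_rms [IsProbabilityMeasure μ] {ι : ℕ → Type*} [∀ m, Fintype (ι m)]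
    {v : ∀ m, ι m → Ω → ℝ} {B : ℝ} {N : ℕ → ℝ} (hB : 0 ≤ B)
    (hN : ∀ m, N m = Fintype.card (ι m)) (hv : ∀ m i, MemLp (v m i) 2 μ)
    (hB' : ∀ m i, ∫ ω, v m i ω ^ 2 ∂μ ≤ B) :
    IsBigOp μ (fun m ω => rms (N m) fun i => v m i ω) fun _ _ => 1 := by
  have hN0 : ∀ m, 0 ≤ N m := fun m => by rw [hN]; positivity
  have hsq : ∀ m ω, rms (N m) (fun i => v m i ω) ^ 2 = (∑ i, v m i ω ^ 2) / N m := fun m ω =>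
    Real.sq_sqrt (div_nonneg (Finset.sum_nonneg fun i _ => sq_nonneg _) (hN0 m))
  refine isBigOp_one_of_sq_integral_le (B := B) (fun m => ?_) fun m => ?_
  · simp only [hsq]
    exact (integrable_finsetSum _ fun i _ => (hv m i).integrable_sq).div_const _
  · simp only [hsq]
    rw [integral_div, integral_finsetSum _ fun i _ => (hv m i).integrable_sq]
    refine div_le_of_le_mul₀ (hN0 m) hB ?_
    calc ∑ i, ∫ ω, v m i ω ^ 2 ∂μ ≤ ∑ _i : ι m, B := Finset.sum_le_sum fun i _ => hB' m i
      _ = B * N m := by simp [hN, mul_comm]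

end Noise

/-! ### A multivariate central limit theorem for row-wise i.i.d. arrays -/

section CLT

open scoped RealInnerProductSpace

variable {Ω : Type*} [MeasurableSpace Ω] {μ : Measure Ω}

/-- Characteristic functions of normalised sums of i.i.d. centred variables of variance `v`, with
no restriction on `v`. -/
lemma tendsto_charFun_pow_of_variance [IsProbabilityMeasure μ] {W : Ω → ℝ} (hW : MemLp W 2 μ)
    (h0 : ∫ ω, W ω ∂μ = 0) {v : ℝ} (hv : ∫ ω, W ω ^ 2 ∂μ = v) (t : ℝ) :
    Tendsto (fun n : ℕ => charFun (μ.map W) ((√n)⁻¹ * t) ^ n) atTop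
      (𝓝 (Complex.exp (-(v * t ^ 2) / 2))) := by
  have hWm : AEMeasurable W μ := hW.1.aemeasurable
  -- A variance of zero makes `W` vanish almost surely; otherwise rescale to unit variance.
  rcases eq_or_ne v 0 with rfl | hv0
  · have hzero : W =ᵐ[μ] fun _ => 0 := by
      have := (integral_eq_zero_iff_of_nonneg (fun ω => sq_nonneg (W ω)) hW.integrable_sq).1 hv
      filter_upwards [this] with ω hω
      simpa using hω
    rw [Measure.map_congr hzero]
    simp
  · have hvpos : 0 < v := lt_of_le_of_ne (hv ▸ integral_nonneg fun ω => sq_nonneg _) hv0.symm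
    have hs : √v ≠ 0 := (Real.sqrt_pos.2 hvpos).ne'
    have key := tendsto_charFun_inv_sqrt_mul_pow (P := μ) (X := fun ω => (√v)⁻¹ * W ω)
      (hWm.const_mul _) (by simp [integral_const_mul, h0])
      (by
        simp only [Pi.pow_apply, mul_pow]
        rw [integral_const_mul, hv, inv_pow, Real.sq_sqrt hvpos.le, inv_mul_cancel₀ hv0])
      (√v * t)
    have hcf : ∀ s : ℝ, charFun (μ.map fun ω => (√v)⁻¹ * W ω) s
        = charFun (μ.map W) ((√v)⁻¹ * s) := fun s => charFun_map_mul_comp hWm _ _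
    have harg : ∀ n : ℕ, (√v)⁻¹ * ((√n)⁻¹ * (√v * t)) = (√n)⁻¹ * t := fun n => by
      rw [mul_left_comm, inv_mul_cancel_left₀ hs]
    have hlim : (-((√v * t : ℝ) : ℂ) ^ 2 / 2) = -(v * t ^ 2) / 2 := by
      rw [← Complex.ofReal_pow, mul_pow, Real.sq_sqrt hvpos.le]
      push_cast
      ring
    simpa only [hcf, harg, hlim] using key

variable {E : Type*} [NormedAddCommGroup E] [InnerProductSpace ℝ E] [FiniteDimensional ℝ E]
  [MeasurableSpace E] [BorelSpace E]

/-- **Central limit theorem** for an array whose rows are i.i.d. with a law `ρ` common to all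
rows: if the rows grow and a probability measure `ν` has the characteristic function of a centred
Gaussian law with the covariance form of `ρ`, the normalised row sums converge to `ν`. -/
theorem tendstoInDistribution_sum_array [IsProbabilityMeasure μ] {ι : ℕ → Type*}
    [∀ m, Fintype (ι m)] {Z : ∀ m, ι m → Ω → E} {Z₀ : Ω → E} {ν : Measure E}
    [IsProbabilityMeasure ν]
    (hcard : Tendsto (fun m => Fintype.card (ι m)) atTop atTop)
    (hindep : ∀ m, iIndepFun (Z m) μ) (hident : ∀ m i, IdentDistrib (Z m i) Z₀ μ μ)
    (hZ₀ : MemLp Z₀ 2 μ) (hmean : ∀ t : E, ∫ ω, ⟪Z₀ ω, t⟫ ∂μ = 0)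
    (hν : ∀ t : E, charFun ν t = Complex.exp (-((∫ ω, ⟪Z₀ ω, t⟫ ^ 2 ∂μ : ℝ) : ℂ) / 2)) :
    TendstoInDistribution (fun m ω => (√(Fintype.card (ι m)))⁻¹ • ∑ i, Z m i ω) atTop
      (id : E → E) (fun _ => μ) ν := by
  have hmeas : ∀ m i, AEMeasurable (Z m i) μ := fun m i => (hident m i).aemeasurable_fst
  have hmeasS : ∀ m, AEMeasurable (fun ω => (√(Fintype.card (ι m)))⁻¹ • ∑ i, Z m i ω) μ :=
    fun m => (Finset.aemeasurable_fun_sum _ fun i _ => hmeas m i).const_smul _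
  refine ⟨hmeasS, aemeasurable_id, ?_⟩
  refine ProbabilityMeasure.tendsto_of_tendsto_charFun fun t => ?_
  have hinner : MemLp (fun ω => ⟪Z₀ ω, t⟫) 2 μ := hZ₀.inner_const t
  have hcf : ∀ m, charFun (μ.map fun ω => (√(Fintype.card (ι m)))⁻¹ • ∑ i, Z m i ω) t
      = charFun (μ.map fun ω => ⟪Z₀ ω, t⟫) ((√(Fintype.card (ι m)))⁻¹ * 1)
        ^ Fintype.card (ι m) := fun m => by
    have h1 : charFun (μ.map fun ω => (√(Fintype.card (ι m)))⁻¹ • ∑ i, Z m i ω) t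
        = charFun (μ.map fun ω => ∑ i, Z m i ω) ((√(Fintype.card (ι m)))⁻¹ • t) := by
      rw [charFun_apply, charFun_apply,
        integral_map (hmeasS m) (by fun_prop),
        integral_map (Finset.aemeasurable_fun_sum _ fun i _ => hmeas m i) (by fun_prop)]
      simp only [real_inner_smul_left, real_inner_smul_right]
    have h2 : charFun (μ.map fun ω => ⟪Z₀ ω, t⟫) ((√(Fintype.card (ι m)))⁻¹ * 1)
        = charFun (μ.map Z₀) ((√(Fintype.card (ι m)))⁻¹ • t) := by
      rw [charFun_apply, charFun_apply, integral_map hinner.1.aemeasurable (by fun_prop),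
        integral_map hZ₀.1.aemeasurable (by fun_prop)]
      simp [real_inner_smul_right]
    rw [h1, h2, (hindep m).charFun_map_fun_sum_eq_prod (hmeas m), Finset.prod_apply]
    simp [fun i => (hident m i).map_eq]
  have hlim := (tendsto_charFun_pow_of_variance hinner (hmean t) rfl 1).comp hcard
  simp only [ProbabilityMeasure.coe_mk, Measure.map_id, hcf, hν t]
  simpa [Function.comp_def] using hlim

end CLT

/-! ### Moments of the noise and of the covariate residuals -/

section Moments

variable {Ω : Type*} [MeasurableSpace Ω] {μ : Measure Ω}

lemma memLp_of_integrable_norm_pow {E : Type*} [NormedAddCommGroup E] {f : Ω → E} {p : ℕ}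
    (hp : p ≠ 0) (hf : AEStronglyMeasurable f μ) (h : Integrable (fun ω => ‖f ω‖ ^ p) μ) :
    MemLp f p μ := by
  rw [← integrable_norm_rpow_iff hf (by exact_mod_cast hp) (ENNReal.natCast_ne_top p)]
  simpa using h

lemma memLp_two_mul {f g : Ω → ℝ} (hf : MemLp f 4 μ) (hg : MemLp g 4 μ) :
    MemLp (fun ω => f ω * g ω) 2 μ := by
  have : ENNReal.HolderTriple 4 4 2 := ⟨by
    rw [← two_mul, show (4 : ENNReal) = 2 * 2 by norm_num,
      ENNReal.mul_inv (by simp) (by simp), ← mul_assoc,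
      ENNReal.mul_inv_cancel (by simp) (by simp), one_mul]⟩
  exact hg.mul' hf

namespace Panel

variable {d K L : ℕ} (P : Panel Ω d K L)

lemma measurable_A (m : ℕ) (i : Idx (P.N m)) : Measurable (P.A m i) := by
  refine Finset.measurable_sum _ fun l _ => Finset.measurable_prod _ fun n _ => ?_
  have := P.measurable_phi m n (i n)
  fun_prop

lemma sigmaA_le (m : ℕ) : P.sigmaA m ≤ (inferInstance : MeasurableSpace Ω) :=
  Measurable.comap_le (measurable_pi_lambda _ fun i => P.measurable_A m i)

lemma measurable_Gamma (m : ℕ) (i : Idx (P.N m)) : Measurable (P.Gamma μ m i) :=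
  stronglyMeasurable_condExp.measurable.mono (P.sigmaA_le m) le_rfl

lemma measurable_eta (m : ℕ) (i : Idx (P.N m)) : Measurable (P.eta μ m i) :=
  (P.measurable_X m i).sub (P.measurable_Gamma m i)

lemma size_eq_card (m : ℕ) : P.size m = Fintype.card (Idx (P.N m)) := by
  simp [size, Fintype.card_pi]

variable {P} {r : Fin d → ℕ} {s2 : ℝ}

lemma BaiCond.memLp_X (h : P.BaiCond μ r) (m : ℕ) (i : Idx (P.N m)) : MemLp (P.X m i) 4 μ := by
  obtain ⟨B, hB⟩ := h.X_moment
  exact_mod_cast memLp_of_integrable_norm_pow four_ne_zero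
    (P.measurable_X m i).aestronglyMeasurable (hB m i).1

lemma BaiCond.memLp_eps [IsProbabilityMeasure μ] (h : P.BaiCond μ r) (m : ℕ)
    (i : Idx (P.N m)) : MemLp (P.eps m i) 4 μ := by
  obtain ⟨B, hB⟩ := h.eps_moment
  have h8 : MemLp (P.eps m i) (8 : ℕ) μ := by
    refine memLp_of_integrable_norm_pow (by norm_num)
      (P.measurable_eps m i).aestronglyMeasurable ?_
    simpa [Even.pow_abs (by decide : Even 8)] using (hB m i).1
  exact h8.mono_exponent (by norm_num)

lemma BaiCond.memLp_eta (h : P.BaiCond μ r) (m : ℕ) (i : Idx (P.N m)) :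
    MemLp (P.eta μ m i) 4 μ :=
  (h.memLp_X m i).sub ((h.memLp_X m i).condExp (by norm_num))

lemma BaiCond.memLp_eta_apply (h : P.BaiCond μ r) (m : ℕ) (i : Idx (P.N m)) (k : Fin K) :
    MemLp (fun ω => P.eta μ m i ω k) 4 μ :=
  (EuclideanSpace.proj (𝕜 := ℝ) k).comp_memLp' (h.memLp_eta m i)

lemma BaiCond.memLp_X_apply (h : P.BaiCond μ r) (m : ℕ) (i : Idx (P.N m)) (k : Fin K) :
    MemLp (fun ω => P.X m i ω k) 4 μ :=
  (EuclideanSpace.proj (𝕜 := ℝ) k).comp_memLp' (h.memLp_X m i)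

lemma BaiCond.integral_eta_apply [IsProbabilityMeasure μ] (h : P.BaiCond μ r) (m : ℕ)
    (i : Idx (P.N m)) (k : Fin K) : ∫ ω, P.eta μ m i ω k ∂μ = 0 := by
  have hX : Integrable (P.X m i) μ := (h.memLp_X m i).integrable (by norm_num)
  have h1 := (EuclideanSpace.proj (𝕜 := ℝ) k).integral_comp_comm
    ((h.memLp_eta m i).integrable (by norm_num))
  have h2 : ∫ ω, P.eta μ m i ω ∂μ = 0 := by
    simp only [eta, Gamma]
    rw [integral_sub hX integrable_condExp, integral_condExp (P.sigmaA_le m), sub_self]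
  rw [h2, map_zero] at h1
  exact h1

/-- The second moments of the covariates are uniformly bounded. -/
lemma BaiCond.exists_integral_X_apply_sq_le [IsProbabilityMeasure μ] (h : P.BaiCond μ r) :
    ∃ B : ℝ, 0 ≤ B ∧ ∀ m i k, ∫ ω, P.X m i ω k ^ 2 ∂μ ≤ B := by
  obtain ⟨B, hB⟩ := h.X_moment
  refine ⟨1 + |B|, by positivity, fun m i k => ?_⟩
  calc ∫ ω, P.X m i ω k ^ 2 ∂μ ≤ ∫ ω, (1 + ‖P.X m i ω‖ ^ 4) ∂μ := by
        refine integral_mono ((h.memLp_X_apply m i k).mono_exponent (by norm_num)).integrable_sq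
          ((integrable_const _).add (hB m i).1) fun ω => ?_
        have h1 : P.X m i ω k ^ 2 ≤ ‖P.X m i ω‖ ^ 2 := by
          rw [← sq_abs, ← Real.norm_eq_abs]
          gcongr
          exact PiLp.norm_apply_le _ _
        have h2 := sq_nonneg (‖P.X m i ω‖ ^ 2 - 1)
        have h3 := sq_nonneg (‖P.X m i ω‖ ^ 2)
        simp only
        nlinarith
    _ = 1 + ∫ ω, ‖P.X m i ω‖ ^ 4 ∂μ := by
        rw [integral_add (integrable_const _) (hB m i).1]
        simp
    _ ≤ 1 + |B| := by gcongr; exact (hB m i).2.trans (le_abs_self B)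

/-- The covariance matrix `E(η_i η_i')`. Identical distribution makes it independent of the sample
and of the observation (`HomoskedCond.gram_eq`), so that a fixed `(m₀, i₀)` represents the limit. -/
noncomputable def gram (P : Panel Ω d K L) (μ : Measure Ω) (m : ℕ) (i : Idx (P.N m)) :
    Matrix (Fin K) (Fin K) ℝ :=
  Matrix.of fun k l => ∫ ω, P.eta μ m i ω k * P.eta μ m i ω l ∂μ

lemma BaiCond.integrable_eta_mul_eta [IsProbabilityMeasure μ] (h : P.BaiCond μ r) (m : ℕ)
    (i : Idx (P.N m)) (k l : Fin K) :
    Integrable (fun ω => P.eta μ m i ω k * P.eta μ m i ω l) μ :=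
  (memLp_two_mul (h.memLp_eta_apply m i k) (h.memLp_eta_apply m i l)).integrable (by norm_num)

/-- Given `η_i`, the noise has mean zero, so it is uncorrelated with `η_i`. -/
lemma NonsingCond.integral_eps_mul_eta [IsProbabilityMeasure μ] (hn : P.NonsingCond μ)
    (h : P.BaiCond μ r) (m : ℕ) (i : Idx (P.N m)) (k : Fin K) :
    ∫ ω, P.eps m i ω * P.eta μ m i ω k ∂μ = 0 := by
  have hle := (P.measurable_eta (μ := μ) m i).comap_le
  have hmeas : StronglyMeasurable[MeasurableSpace.comap (P.eta μ m i) inferInstance]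
      fun ω => P.eta μ m i ω k :=
    ((by fun_prop : Measurable fun x : EuclideanSpace ℝ (Fin K) => x k).comp
      (comap_measurable _)).stronglyMeasurable
  have hpull := condExp_mul_of_stronglyMeasurable_right (μ := μ) hmeas
    ((memLp_two_mul (h.memLp_eps m i) (h.memLp_eta_apply m i k)).integrable (by norm_num))
    ((h.memLp_eps m i).integrable (by norm_num))
  calc ∫ ω, P.eps m i ω * P.eta μ m i ω k ∂μ
      = ∫ ω, (μ[P.eps m i * fun ω => P.eta μ m i ω k |
          MeasurableSpace.comap (P.eta μ m i) inferInstance]) ω ∂μ :=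
        (integral_condExp hle).symm
    _ = ∫ _, (0 : ℝ) ∂μ := by
        refine integral_congr_ae ?_
        filter_upwards [hpull, hn.eps_cond_mean m i] with ω h1 h2
        rw [h1, Pi.mul_apply, h2, zero_mul]
    _ = 0 := by simp

/-- Conditional homoskedasticity factorises `E(ε_i² η_{ik} η_{il})`. -/
lemma HomoskedCond.integral_eps_sq_mul_eta_mul_eta [IsProbabilityMeasure μ]
    (hh : P.HomoskedCond μ s2) (h : P.BaiCond μ r) (m : ℕ) (i : Idx (P.N m)) (k l : Fin K) :
    ∫ ω, P.eps m i ω ^ 2 * (P.eta μ m i ω k * P.eta μ m i ω l) ∂μ = s2 * P.gram μ m i k l := by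
  have hle := (P.measurable_eta (μ := μ) m i).comap_le
  have hmeas : StronglyMeasurable[MeasurableSpace.comap (P.eta μ m i) inferInstance]
      fun ω => P.eta μ m i ω k * P.eta μ m i ω l :=
    ((by fun_prop : Measurable fun x : EuclideanSpace ℝ (Fin K) => x k * x l).comp
      (comap_measurable _)).stronglyMeasurable
  have he2 : MemLp (fun ω => P.eps m i ω ^ 2) 2 μ := by
    simpa only [sq] using memLp_two_mul (h.memLp_eps m i) (h.memLp_eps m i)
  have hpull := condExp_mul_of_stronglyMeasurable_right (μ := μ) hmeas
    (he2.integrable_mul (memLp_two_mul (h.memLp_eta_apply m i k) (h.memLp_eta_apply m i l)))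
    (he2.integrable (by norm_num))
  calc ∫ ω, P.eps m i ω ^ 2 * (P.eta μ m i ω k * P.eta μ m i ω l) ∂μ
      = ∫ ω, (μ[(fun ω => P.eps m i ω ^ 2) * fun ω => P.eta μ m i ω k * P.eta μ m i ω l |
          MeasurableSpace.comap (P.eta μ m i) inferInstance]) ω ∂μ :=
        (integral_condExp hle).symm
    _ = ∫ ω, s2 * (P.eta μ m i ω k * P.eta μ m i ω l) ∂μ := by
        refine integral_congr_ae ?_
        filter_upwards [hpull, hh.cond_var m i] with ω h1 h2
        rw [h1, Pi.mul_apply, h2]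
    _ = s2 * P.gram μ m i k l := integral_const_mul _ _

/-- The quadratic form of `E(η_i η_i')`. -/
lemma BaiCond.integral_sq_sum_eta [IsProbabilityMeasure μ] (h : P.BaiCond μ r) (m : ℕ)
    (i : Idx (P.N m)) (c : Fin K → ℝ) :
    ∫ ω, (∑ k, c k * P.eta μ m i ω k) ^ 2 ∂μ = c ⬝ᵥ (P.gram μ m i).mulVec c := by
  have hexp : ∀ ω, (∑ k, c k * P.eta μ m i ω k) ^ 2
      = ∑ k, ∑ l, c k * c l * (P.eta μ m i ω k * P.eta μ m i ω l) := fun ω => by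
    rw [sq, Finset.sum_mul_sum]
    exact Finset.sum_congr rfl fun k _ => Finset.sum_congr rfl fun l _ => by ring
  have hint := fun k l => (h.integrable_eta_mul_eta m i k l).const_mul (c k * c l)
  simp only [hexp]
  rw [integral_finsetSum _ fun k _ => integrable_finsetSum _ fun l _ => hint k l]
  simp only [dotProduct, Matrix.mulVec, Finset.mul_sum]
  refine Finset.sum_congr rfl fun k _ => ?_
  rw [integral_finsetSum _ fun l _ => hint k l]
  refine Finset.sum_congr rfl fun l _ => ?_
  rw [integral_const_mul, gram, Matrix.of_apply]
  ring

/-- The quadratic form of the covariance of the score `ε_i η_i`. -/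
lemma HomoskedCond.integral_sq_eps_mul_sum_eta [IsProbabilityMeasure μ]
    (hh : P.HomoskedCond μ s2) (h : P.BaiCond μ r) (m : ℕ) (i : Idx (P.N m)) (c : Fin K → ℝ) :
    ∫ ω, (P.eps m i ω * ∑ k, c k * P.eta μ m i ω k) ^ 2 ∂μ
      = s2 * (c ⬝ᵥ (P.gram μ m i).mulVec c) := by
  have hexp : ∀ ω, (P.eps m i ω * ∑ k, c k * P.eta μ m i ω k) ^ 2
      = ∑ k, ∑ l, c k * c l * (P.eps m i ω ^ 2 * (P.eta μ m i ω k * P.eta μ m i ω l)) :=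
    fun ω => by
      rw [mul_pow, sq (∑ k, c k * P.eta μ m i ω k), Finset.sum_mul_sum, Finset.mul_sum]
      refine Finset.sum_congr rfl fun k _ => ?_
      rw [Finset.mul_sum]
      exact Finset.sum_congr rfl fun l _ => by ring
  have he2 : MemLp (fun ω => P.eps m i ω ^ 2) 2 μ := by
    simpa only [sq] using memLp_two_mul (h.memLp_eps m i) (h.memLp_eps m i)
  have hint : ∀ k l, Integrable (fun ω => c k * c l *
      (P.eps m i ω ^ 2 * (P.eta μ m i ω k * P.eta μ m i ω l))) μ := fun k l =>
    (he2.integrable_mul (memLp_two_mul (h.memLp_eta_apply m i k)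
      (h.memLp_eta_apply m i l))).const_mul (c k * c l)
  simp only [hexp]
  rw [integral_finsetSum _ fun k _ => integrable_finsetSum _ fun l _ => hint k l]
  simp only [dotProduct, Matrix.mulVec, Finset.mul_sum]
  refine Finset.sum_congr rfl fun k _ => ?_
  rw [integral_finsetSum _ fun l _ => hint k l]
  refine Finset.sum_congr rfl fun l _ => ?_
  rw [integral_const_mul, hh.integral_eps_sq_mul_eta_mul_eta h]
  ring

lemma NonsingCond.posDef_gram [IsProbabilityMeasure μ] (hn : P.NonsingCond μ)
    (h : P.BaiCond μ r) (m : ℕ) (i : Idx (P.N m)) : (P.gram μ m i).PosDef := by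
  have hpsd : (P.gram μ m i).PosSemidef := by
    refine .of_dotProduct_mulVec_nonneg ?_ fun c => ?_
    · ext k l
      simp [gram, mul_comm]
    · rw [star_trivial, ← h.integral_sq_sum_eta]
      exact integral_nonneg fun ω => sq_nonneg _
  exact hpsd.posDef_iff_isUnit.2 (hn.nonsing m i)

/-- Expectations of functions of `(ε_i, η_i)` do not depend on the observation. -/
lemma HomoskedCond.integral_comp_eq (hh : P.HomoskedCond μ s2)
    {g : ℝ × EuclideanSpace ℝ (Fin K) → ℝ} (hg : Measurable g) (m m' : ℕ) (i : Idx (P.N m))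
    (j : Idx (P.N m')) :
    ∫ ω, g (P.eps m i ω, P.eta μ m i ω) ∂μ = ∫ ω, g (P.eps m' j ω, P.eta μ m' j ω) ∂μ :=
  ((hh.ident m m' i j).comp hg).integral_eq

lemma HomoskedCond.gram_eq (hh : P.HomoskedCond μ s2) (m m' : ℕ) (i : Idx (P.N m))
    (j : Idx (P.N m')) : P.gram μ m i = P.gram μ m' j := by
  ext k l
  exact hh.integral_comp_eq (g := fun x => x.2 k * x.2 l) (by fun_prop) m m' i j

/-- Centred functions of `(ε_i, η_i)` are uncorrelated across observations. -/
lemma HomoskedCond.integral_comp_mul_comp_eq_zero (hh : P.HomoskedCond μ s2)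
    {g : ℝ × EuclideanSpace ℝ (Fin K) → ℝ} (hg : Measurable g)
    (h0 : ∀ m i, ∫ ω, g (P.eps m i ω, P.eta μ m i ω) ∂μ = 0) (m : ℕ) (i j : Idx (P.N m))
    (hij : i ≠ j) :
    ∫ ω, g (P.eps m i ω, P.eta μ m i ω) * g (P.eps m j ω, P.eta μ m j ω) ∂μ = 0 := by
  have hmeas : ∀ i : Idx (P.N m), Measurable fun ω => g (P.eps m i ω, P.eta μ m i ω) :=
    fun i => hg.comp ((P.measurable_eps m i).prodMk (P.measurable_eta m i))
  have hind := ((hh.indep m).indepFun hij).comp hg hg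
  have := hind.integral_fun_mul_eq_mul_integral (hmeas i).aestronglyMeasurable
    (hmeas j).aestronglyMeasurable
  simp only [Function.comp_apply] at this
  rw [this]
  exact mul_eq_zero_of_left (h0 m i) _

end Panel

end Moments

namespace Panel

/-! ### The remainder of the score -/

section Remainder

variable {Ω : Type*} [MeasurableSpace Ω] {μ : Measure Ω} {d K L : ℕ} {P : Panel Ω d K L}
  {r : Fin d → ℕ} {xiX xiB xiA : ℕ → Ω → ℝ} {s2 : ℝ}

lemma size_nonneg (m : ℕ) : 0 ≤ P.size m := by
  rw [P.size_eq_card]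
  positivity

variable (P) in
/-- The estimation error `Γ_X - Γ̂_X`, which is also `η̂ - η`. -/
noncomputable def gammaErr (μ : Measure Ω) (m : ℕ) (i : Idx (P.N m)) (ω : Ω) (k : Fin K) : ℝ :=
  P.Gamma μ m i ω k - P.GammaHat m i ω k

variable (P) in
/-- The estimation error `𝒜 - 𝒜̂`. -/
noncomputable def tensorErr (m : ℕ) (i : Idx (P.N m)) (ω : Ω) : ℝ := P.A m i ω - P.AHat m i ω

variable (P) in
/-- The leading term of the score, `N^{-1/2} ∑ ε_i η_i`. -/
noncomputable def score (μ : Measure Ω) (m : ℕ) (ω : Ω) (k : Fin K) : ℝ :=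
  (√(P.size m))⁻¹ * ∑ i, P.eps m i ω * P.eta μ m i ω k

variable (P) in
/-- The estimated score at the true slope, `N^{-1/2} ∑ η̂_i (Y_i - Γ̂_{Y,i} - η̂_i'β⁰)`. -/
noncomputable def scoreHat (m : ℕ) (ω : Ω) (k : Fin K) : ℝ :=
  (√(P.size m))⁻¹ * ∑ i, P.etaHat m i ω k *
    (P.Y m i ω - P.GammaYHat m i ω - ∑ l, P.etaHat m i ω l * P.beta0 l)

lemma etaHat_apply (m : ℕ) (i : Idx (P.N m)) (ω : Ω) (k : Fin K) :
    P.etaHat m i ω k = P.eta μ m i ω k + P.gammaErr μ m i ω k := by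
  simp [etaHat, eta, gammaErr]

/-- The residual at the true slope: the preliminary estimates of `β⁰` and of `𝒜` enter only
through their errors. -/
lemma residual_eq (m : ℕ) (i : Idx (P.N m)) (ω : Ω) :
    P.Y m i ω - P.GammaYHat m i ω - ∑ l, P.etaHat m i ω l * P.beta0 l
      = P.eps m i ω + P.tensorErr m i ω
        + ∑ l, P.GammaHat m i ω l * (P.beta0 l - P.betaTilde m ω l) := by
  have h : ∑ l, P.etaHat m i ω l * P.beta0 l
      = (∑ l, P.X m i ω l * P.beta0 l) - ∑ l, P.GammaHat m i ω l * P.beta0 l := by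
    rw [← Finset.sum_sub_distrib]
    exact Finset.sum_congr rfl fun l _ => by simp [etaHat, sub_mul]
  have h' : ∑ l, P.GammaHat m i ω l * (P.beta0 l - P.betaTilde m ω l)
      = (∑ l, P.GammaHat m i ω l * P.beta0 l)
        - ∑ l, P.GammaHat m i ω l * P.betaTilde m ω l := by
    rw [← Finset.sum_sub_distrib]
    exact Finset.sum_congr rfl fun l _ => mul_sub _ _ _
  rw [h, h', Y, GammaYHat, tensorErr]
  ring

/-- Every remainder term pairs a noise tensor with an estimation error independent of it, or two
estimation errors. -/
lemma scoreHat_sub_score (m : ℕ) (ω : Ω) (k : Fin K) :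
    P.scoreHat m ω k - P.score μ m ω k =
      (√(P.size m))⁻¹ * ∑ i, P.eps m i ω * P.gammaErr μ m i ω k
      + (√(P.size m))⁻¹ * ∑ i, P.eta μ m i ω k * P.tensorErr m i ω
      + (√(P.size m))⁻¹ * ∑ i, P.gammaErr μ m i ω k * P.tensorErr m i ω
      + ∑ l, ((√(P.size m))⁻¹ * ∑ i, P.eta μ m i ω k * P.GammaHat m i ω l)
          * (P.beta0 l - P.betaTilde m ω l)
      + ∑ l, ((√(P.size m))⁻¹ * ∑ i, P.gammaErr μ m i ω k * P.GammaHat m i ω l)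
          * (P.beta0 l - P.betaTilde m ω l) := by
  have hswap : ∀ v : Idx (P.N m) → ℝ,
      ∑ l, ((√(P.size m))⁻¹ * ∑ i, v i * P.GammaHat m i ω l)
          * (P.beta0 l - P.betaTilde m ω l)
        = (√(P.size m))⁻¹ * ∑ i, v i *
          ∑ l, P.GammaHat m i ω l * (P.beta0 l - P.betaTilde m ω l) := fun v => by
    simp only [Finset.mul_sum, Finset.sum_mul]
    rw [Finset.sum_comm]
    exact Finset.sum_congr rfl fun i _ => Finset.sum_congr rfl fun l _ => by ring
  rw [hswap, hswap, scoreHat, score]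
  simp only [residual_eq]
  simp only [etaHat_apply (μ := μ)]
  rw [← mul_sub, ← mul_add, ← mul_add, ← mul_add, ← mul_add]
  congr 1
  simp only [← Finset.sum_add_distrib, ← Finset.sum_sub_distrib]
  exact Finset.sum_congr rfl fun i _ => by ring

lemma measurable_gammaErr (m : ℕ) (i : Idx (P.N m)) (k : Fin K) :
    Measurable fun ω => P.gammaErr μ m i ω k := by
  have h1 := P.measurable_Gamma (μ := μ) m i
  have h2 := P.measurable_GammaHat m i
  unfold gammaErr
  fun_prop

lemma RateCond.isBigOp_rms_gammaErr (h : P.RateCond μ xiX xiB xiA) (k : Fin K) :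
    IsBigOp μ (fun m ω => rms (P.size m) fun i => P.gammaErr μ m i ω k) xiX := by
  simpa only [rms, gammaErr, sub_sq_comm] using h.Gamma_rate k

lemma RateCond.isLittleOp_rms_gammaErr (h : P.RateCond μ xiX xiB xiA) (k : Fin K) :
    IsLittleOp μ (fun m ω => rms (P.size m) fun i => P.gammaErr μ m i ω k) fun _ _ => 1 :=
  (h.isBigOp_rms_gammaErr k).trans_isLittleOp h.xiX_tendsto

lemma RateCond.isBigOp_rms_tensorErr (h : P.RateCond μ xiX xiB xiA) :
    IsBigOp μ (fun m ω => rms (P.size m) fun i => P.tensorErr m i ω) xiA := by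
  simpa only [rms, tensorErr, sub_sq_comm] using h.A_rate

lemma RateCond.isBigOp_beta_apply (h : P.RateCond μ xiX xiB xiA) (l : Fin K) :
    IsBigOp μ (fun m ω => P.beta0 l - P.betaTilde m ω l) xiB :=
  h.beta_rate.mono fun m ω => by
    rw [abs_norm]
    exact PiLp.norm_apply_le (P.beta0 - P.betaTilde m ω) l

section

variable [IsProbabilityMeasure μ] (hbai : P.BaiCond μ r) (hh : P.HomoskedCond μ s2)
  (m₀ : ℕ) (i₀ : Idx (P.N m₀))

include hbai hh i₀

/-- `N^{-1/2} ∑ η_{ik} w_i` is of the order of the root mean square of the weights `w`. -/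
lemma isBigOp_sum_eta_mul (k : Fin K) {w : ∀ m, Idx (P.N m) → Ω → ℝ}
    (hw : ∀ m i, Measurable (w m i))
    (hindep : ∀ m, IndepFun (fun ω i => P.eta μ m i ω k) (fun ω i => w m i ω) μ) :
    IsBigOp μ (fun m ω => (√(P.size m))⁻¹ * ∑ i, P.eta μ m i ω k * w m i ω)
      (fun m ω => rms (P.size m) fun i => w m i ω) := by
  refine isBigOp_sum_mul_of_indepFun (B := ∫ ω, P.eta μ m₀ i₀ ω k ^ 2 ∂μ) P.size
    (integral_nonneg fun ω => sq_nonneg _)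
    (fun m i => (hbai.memLp_eta_apply m i k).mono_exponent (by norm_num)) hw (fun m i => ?_)
    (fun m i j hij => ?_) hindep
  · exact (hh.integral_comp_eq (g := fun x => x.2 k ^ 2) (by fun_prop) m m₀ i i₀).le
  · exact hh.integral_comp_mul_comp_eq_zero (g := fun x => x.2 k) (by fun_prop)
      (fun m i => hbai.integral_eta_apply m i k) m i j hij

omit i₀ in
/-- `N^{-1/2} ∑ ε_i w_i` is of the order of the root mean square of the weights `w`. -/
lemma isBigOp_sum_eps_mul (hs2 : 0 ≤ s2) {w : ∀ m, Idx (P.N m) → Ω → ℝ}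
    (hw : ∀ m i, Measurable (w m i))
    (hindep : ∀ m, IndepFun (fun ω i => P.eps m i ω) (fun ω i => w m i ω) μ) :
    IsBigOp μ (fun m ω => (√(P.size m))⁻¹ * ∑ i, P.eps m i ω * w m i ω)
      (fun m ω => rms (P.size m) fun i => w m i ω) := by
  refine isBigOp_sum_mul_of_indepFun (B := s2) P.size hs2
    (fun m i => (hbai.memLp_eps m i).mono_exponent (by norm_num)) hw
    (fun m i => (hh.var_eq m i).le) (fun m i j hij => ?_) hindep
  exact hh.integral_comp_mul_comp_eq_zero (g := fun x => x.1) (by fun_prop)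
      (fun m i => hbai.eps_mean m i) m i j hij

lemma isBigOp_rms_eta (k : Fin K) :
    IsBigOp μ (fun m ω => rms (P.size m) fun i => P.eta μ m i ω k) fun _ _ => 1 :=
  isBigOp_rms (B := ∫ ω, P.eta μ m₀ i₀ ω k ^ 2 ∂μ) (integral_nonneg fun ω => sq_nonneg _)
    P.size_eq_card (fun m i => (hbai.memLp_eta_apply m i k).mono_exponent (by norm_num))
    fun m i => (hh.integral_comp_eq (g := fun x => x.2 k ^ 2) (by fun_prop) m m₀ i i₀).le

/-- The estimates `Γ̂_X = X - η - (Γ_X - Γ̂_X)` are bounded in mean square. -/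
lemma isBigOp_rms_GammaHat (hrate : P.RateCond μ xiX xiB xiA) (k : Fin K) :
    IsBigOp μ (fun m ω => rms (P.size m) fun i => P.GammaHat m i ω k) fun _ _ => 1 := by
  obtain ⟨B, hB0, hB⟩ := hbai.exists_integral_X_apply_sq_le
  have hX : IsBigOp μ (fun m ω => rms (P.size m) fun i => P.X m i ω k) fun _ _ => 1 :=
    isBigOp_rms hB0 P.size_eq_card
      (fun m i => (hbai.memLp_X_apply m i k).mono_exponent (by norm_num)) fun m i => hB m i k
  have hsum := (hX.add (((isBigOp_rms_eta hbai hh m₀ i₀ k).add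
    (hrate.isLittleOp_rms_gammaErr k).isBigOp).const_mul (√2))).const_mul (√2)
  refine hsum.mono fun m ω => ?_
  rw [abs_of_nonneg (rms_nonneg _ _)]
  refine le_trans ?_ (le_abs_self _)
  have hG : (fun i => P.GammaHat m i ω k)
      = fun i => P.X m i ω k - (P.eta μ m i ω k + P.gammaErr μ m i ω k) := by
    funext i
    simp [eta, gammaErr]
  rw [hG]
  refine (rms_sub_le (size_nonneg m) _ _).trans ?_
  gcongr
  exact rms_add_le (size_nonneg m) _ _

/-- The estimated score is asymptotically equivalent to `N^{-1/2} ∑ ε_i η_i`. -/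
lemma isLittleOp_scoreHat_sub_score (hs2 : 0 ≤ s2) (hrate : P.RateCond μ xiX xiB xiA)
    (hindep : P.IndepCond μ) (k : Fin K) :
    IsLittleOp μ (fun m ω => P.scoreHat m ω k - P.score μ m ω k) fun _ _ => 1 := by
  simp only [scoreHat_sub_score]
  refine (((IsLittleOp.add ?_ ?_).add ?_).add (IsLittleOp.sum _ fun l _ => ?_)).add
    (IsLittleOp.sum _ fun l _ => ?_)
  · refine (isBigOp_sum_eps_mul hbai hh hs2 (fun m i => measurable_gammaErr m i k)
      fun m => ?_).trans_isLittleOp (hrate.isLittleOp_rms_gammaErr k)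
    exact (hindep.eps_Gamma m k).comp (φ := id) (ψ := fun p i => p.1 i - p.2 i)
      measurable_id (by fun_prop)
  · refine (isBigOp_sum_eta_mul hbai hh m₀ i₀ k
      (fun m i => (P.measurable_A m i).sub (P.measurable_AHat m i)) fun m => ?_).trans_isLittleOp
      (hrate.isBigOp_rms_tensorErr.trans_isLittleOp hrate.xiA_tendsto)
    exact (hindep.eta_A m k).comp (φ := id) (ψ := fun p i => p.1 i - p.2 i)
      measurable_id (by fun_prop)
  · have h := (((hrate.isBigOp_rms_gammaErr k).mul
      hrate.isBigOp_rms_tensorErr).trans_isLittleOp hrate.xiX_xiA).sqrt_mul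
    refine h.mono fun m ω => ?_
    exact (abs_inv_sqrt_mul_sum_mul_le (size_nonneg m) _ _).trans (le_abs_self _)
  · have hG : ∀ m i, Measurable fun ω => P.GammaHat m i ω l := fun m i => by
      have := P.measurable_GammaHat m i
      fun_prop
    have h1 := isBigOp_sum_eta_mul hbai hh m₀ i₀ k hG fun m => hindep.eta_Gamma m k l
    have h2 := h1.mul (IsBigOp.refl (μ := μ) fun m ω => P.beta0 l - P.betaTilde m ω l)
    exact h2.trans_isLittleOp ((isBigOp_rms_GammaHat hbai hh m₀ i₀ hrate l).mul_isLittleOp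
      ((hrate.isBigOp_beta_apply l).trans_isLittleOp hrate.xiB_tendsto))
  · have h := (((hrate.isBigOp_rms_gammaErr k).mul
      (hrate.isBigOp_beta_apply l)).trans_isLittleOp hrate.xiX_xiB).sqrt_mul
    refine ((isBigOp_rms_GammaHat hbai hh m₀ i₀ hrate l).mul_isLittleOp h).mono fun m ω => ?_
    rw [abs_mul]
    refine (mul_le_mul_of_nonneg_right
      (abs_inv_sqrt_mul_sum_mul_le (size_nonneg m) _ _) (abs_nonneg _)).trans (le_of_eq ?_)
    rw [abs_mul, abs_mul, abs_mul, abs_of_nonneg (rms_nonneg _ _),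
      abs_of_nonneg (Real.sqrt_nonneg _), abs_of_nonneg (rms_nonneg _ _)]
    ring

end

end Remainder

/-! ### Measurability of random matrices -/

section Measurability

variable {Ω : Type*} [MeasurableSpace Ω] {κ : Type*} [Fintype κ] [DecidableEq κ]
  {A : Ω → Matrix κ κ ℝ}

lemma measurable_matrix_det (hA : ∀ k l, Measurable fun ω => A ω k l) :
    Measurable fun ω => (A ω).det := by
  simp only [Matrix.det_apply]
  exact Finset.measurable_sum _ fun σ _ =>
    (Finset.measurable_prod _ fun k _ => hA (σ k) k).const_smul (Equiv.Perm.sign σ)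

lemma measurable_matrix_inv_apply (hA : ∀ k l, Measurable fun ω => A ω k l) (k l : κ) :
    Measurable fun ω => (A ω)⁻¹ k l := by
  simp only [Matrix.inv_def, Ring.inverse_eq_inv', Matrix.smul_apply, smul_eq_mul,
    Matrix.adjugate_apply]
  refine (measurable_matrix_det hA).inv.mul (measurable_matrix_det fun a b => ?_)
  simp only [Matrix.updateRow_apply]
  split_ifs
  · exact measurable_const
  · exact hA a b

end Measurability

/-! ### Consistency of the second-moment matrices -/

section Consistency

variable {Ω : Type*} [MeasurableSpace Ω] {μ : Measure Ω} {d K L : ℕ} {P : Panel Ω d K L}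
  {r : Fin d → ℕ} {xiX xiB xiA : ℕ → Ω → ℝ} {s2 : ℝ}

lemma Growth.eventually_nonempty_idx (h : P.Growth) : ∀ᶠ m in atTop, Nonempty (Idx (P.N m)) := by
  have hpos : ∀ᶠ m in atTop, ∀ n, 0 < P.N m n :=
    eventually_all.2 fun n => (h.tendsto n).eventually_gt_atTop 0
  filter_upwards [hpos] with m hm
  exact ⟨fun n => ⟨0, hm n⟩⟩

lemma Growth.tendsto_card (h : P.Growth) (n : Fin d) :
    Tendsto (fun m => Fintype.card (Idx (P.N m))) atTop atTop := by
  refine tendsto_atTop_mono' atTop ?_ (h.tendsto n)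
  filter_upwards [h.eventually_nonempty_idx] with m hm
  have hcard : Fintype.card (Idx (P.N m)) = ∏ n, P.N m n := by simp [Fintype.card_pi]
  refine Nat.le_of_dvd Fintype.card_pos ?_
  rw [hcard]
  exact Finset.dvd_prod_of_mem _ (Finset.mem_univ n)

lemma Growth.tendsto_size (h : P.Growth) (n : Fin d) : Tendsto P.size atTop atTop :=
  (tendsto_natCast_atTop_atTop.comp (h.tendsto_card n)).congr fun m => (P.size_eq_card m).symm

variable [IsProbabilityMeasure μ]

/-- The law of large numbers for `η_i η_i'`, by Chebyshev's inequality. -/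
lemma isLittleOp_gram_sub (hgrowth : P.Growth) (n : Fin d) (hbai : P.BaiCond μ r)
    (hh : P.HomoskedCond μ s2) (m₀ : ℕ) (i₀ : Idx (P.N m₀)) (k l : Fin K) :
    IsLittleOp μ (fun m ω => (P.size m)⁻¹ * ∑ i, P.eta μ m i ω k * P.eta μ m i ω l
      - P.gram μ m₀ i₀ k l) fun _ _ => 1 := by
  set a := P.gram μ m₀ i₀ k l
  have hmean : ∀ m i, ∫ ω, (P.eta μ m i ω k * P.eta μ m i ω l - a) ∂μ = 0 := fun m i => by
    rw [integral_sub (hbai.integrable_eta_mul_eta m i k l) (integrable_const _)]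
    have : ∫ ω, P.eta μ m i ω k * P.eta μ m i ω l ∂μ = a :=
      congrFun (congrFun (hh.gram_eq m m₀ i i₀) k) l
    simp [this]
  have hsum := isBigOp_sum_of_uncorrelated (μ := μ)
    (u := fun m (i : Idx (P.N m)) ω => P.eta μ m i ω k * P.eta μ m i ω l - a)
    (B := ∫ ω, (P.eta μ m₀ i₀ ω k * P.eta μ m₀ i₀ ω l - a) ^ 2 ∂μ)
    (integral_nonneg fun ω => sq_nonneg _) P.size_eq_card
    (fun m i => (memLp_two_mul (hbai.memLp_eta_apply m i k)
      (hbai.memLp_eta_apply m i l)).sub (memLp_const a))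
    (fun m i => (hh.integral_comp_eq (g := fun x => (x.2 k * x.2 l - a) ^ 2)
      (by fun_prop) m m₀ i i₀).le)
    (hh.integral_comp_mul_comp_eq_zero (g := fun x => x.2 k * x.2 l - a) (by fun_prop) hmean)
  have hsize := hgrowth.tendsto_size n
  have hsqrt : Tendsto (fun m => (√(P.size m))⁻¹) atTop (𝓝 0) :=
    tendsto_inv_atTop_zero.comp (Real.tendsto_sqrt_atTop.comp hsize)
  have h1 := hsum.mul_isLittleOp (isLittleOp_const_of_tendsto (μ := μ) hsqrt)
  -- Centring by `a` leaves the factor `N⁻¹ * N`, which differs from `1` for empty samples only.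
  have h2 : Tendsto (fun m => ((P.size m)⁻¹ * P.size m - 1) * a) atTop (𝓝 0) := by
    refine tendsto_const_nhds.congr' ?_
    filter_upwards [hsize.eventually_gt_atTop 0] with m hm
    rw [inv_mul_cancel₀ hm.ne', sub_self, zero_mul]
  refine (h1.add (isLittleOp_const_of_tendsto h2)).mono fun m ω => le_of_eq (congrArg _ ?_)
  have hcard : ∑ _i : Idx (P.N m), a = P.size m * a := by
    rw [Finset.sum_const, P.size_eq_card m, nsmul_eq_mul, Finset.card_univ]
  have hinv : (√(P.size m))⁻¹ * (√(P.size m))⁻¹ = (P.size m)⁻¹ := by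
    rw [← mul_inv, Real.mul_self_sqrt (size_nonneg m)]
  rw [mul_right_comm, hinv, Finset.sum_sub_distrib, hcard]
  ring

/-- The estimation error in `Γ̂_X` does not affect the limit of `Ω̂_X`. -/
lemma isLittleOp_OmegaHat_sub (hgrowth : P.Growth) (n : Fin d) (hbai : P.BaiCond μ r)
    (hh : P.HomoskedCond μ s2) (hrate : P.RateCond μ xiX xiB xiA) (m₀ : ℕ)
    (i₀ : Idx (P.N m₀)) (k l : Fin K) :
    IsLittleOp μ (fun m ω => P.OmegaHat m ω k l - P.gram μ m₀ i₀ k l) fun _ _ => 1 := by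
  have hcross : ∀ {v w : ∀ m, Idx (P.N m) → Ω → ℝ},
      IsBigOp μ (fun m ω => rms (P.size m) fun i => v m i ω) (fun _ _ => 1) →
      IsLittleOp μ (fun m ω => rms (P.size m) fun i => w m i ω) (fun _ _ => 1) →
      IsLittleOp μ (fun m ω => (P.size m)⁻¹ * ∑ i, v m i ω * w m i ω) fun _ _ => 1 :=
    fun hv hw => (hv.mul_isLittleOp hw).mono fun m ω =>
      (abs_inv_mul_sum_mul_le (size_nonneg m) _ _).trans (le_abs_self _)
  have hη := fun k => isBigOp_rms_eta hbai hh m₀ i₀ k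
  have hD := fun k => hrate.isLittleOp_rms_gammaErr k
  refine ((((isLittleOp_gram_sub hgrowth n hbai hh m₀ i₀ k l).add (hcross (hη k) (hD l))).add
    (hcross (hη l) (hD k))).add (hcross (hD k).isBigOp (hD l))).mono
      fun m ω => le_of_eq (congrArg _ ?_)
  rw [OmegaHat, Matrix.of_apply]
  simp only [etaHat_apply (μ := μ), sub_add_eq_add_sub, ← mul_add, ← Finset.sum_add_distrib]
  congr 2
  exact Finset.sum_congr rfl fun i _ => by ring

lemma isBigOp_score (hbai : P.BaiCond μ r) (hn : P.NonsingCond μ) (hh : P.HomoskedCond μ s2)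
    (m₀ : ℕ) (i₀ : Idx (P.N m₀)) (k : Fin K) :
    IsBigOp μ (fun m ω => P.score μ m ω k) fun _ _ => 1 :=
  isBigOp_sum_of_uncorrelated (μ := μ)
    (u := fun m (i : Idx (P.N m)) ω => P.eps m i ω * P.eta μ m i ω k)
    (B := ∫ ω, (P.eps m₀ i₀ ω * P.eta μ m₀ i₀ ω k) ^ 2 ∂μ)
    (integral_nonneg fun ω => sq_nonneg _) P.size_eq_card
    (fun m i => memLp_two_mul (hbai.memLp_eps m i) (hbai.memLp_eta_apply m i k))
    (fun m i => (hh.integral_comp_eq (g := fun x => (x.1 * x.2 k) ^ 2)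
      (by fun_prop) m m₀ i i₀).le)
    (hh.integral_comp_mul_comp_eq_zero (g := fun x => x.1 * x.2 k) (by fun_prop)
      fun m i => hn.integral_eps_mul_eta hbai m i k)

/-- On an event of probability approaching one, `Ω̂_X` is invertible with inverse close to the
inverse of the limit. -/
lemma tendsto_measure_OmegaHat_inv (hgrowth : P.Growth) (n : Fin d) (hbai : P.BaiCond μ r)
    (hn : P.NonsingCond μ) (hh : P.HomoskedCond μ s2) (hrate : P.RateCond μ xiX xiB xiA)
    (m₀ : ℕ) (i₀ : Idx (P.N m₀)) {V : Set (Matrix (Fin K) (Fin K) ℝ)}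
    (hV : V ∈ 𝓝 (P.gram μ m₀ i₀)⁻¹) :
    Tendsto (fun m => μ {ω | ¬ (IsUnit (P.OmegaHat m ω).det ∧ (P.OmegaHat m ω)⁻¹ ∈ V)})
      atTop (𝓝 0) := by
  have hdet : (P.gram μ m₀ i₀).det ≠ 0 := (hn.posDef_gram hbai m₀ i₀).det_pos.ne'
  have hinv : ContinuousAt Inv.inv (P.gram μ m₀ i₀) := by
    refine continuousAt_matrix_inv _ ?_
    rw [Ring.inverse_eq_inv']
    exact continuousAt_inv₀ hdet
  have hU : {M : Matrix (Fin K) (Fin K) ℝ | IsUnit M.det ∧ M⁻¹ ∈ V} ∈ 𝓝 (P.gram μ m₀ i₀) := by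
    refine inter_mem ?_ (hinv hV)
    have := (continuous_id.matrix_det (n := Fin K) (R := ℝ)).continuousAt.eventually_ne hdet
    filter_upwards [this] with M hM
    exact isUnit_iff_ne_zero.2 hM
  exact tendsto_measure_notMem_nhds (A := fun m ω k l => P.OmegaHat m ω k l)
    (fun k l => isLittleOp_OmegaHat_sub hgrowth n hbai hh hrate m₀ i₀ k l) hU

lemma isLittleOp_OmegaHat_inv_sub (hgrowth : P.Growth) (n : Fin d) (hbai : P.BaiCond μ r)
    (hn : P.NonsingCond μ) (hh : P.HomoskedCond μ s2) (hrate : P.RateCond μ xiX xiB xiA)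
    (m₀ : ℕ) (i₀ : Idx (P.N m₀)) (k l : Fin K) :
    IsLittleOp μ (fun m ω => (P.OmegaHat m ω)⁻¹ k l - (P.gram μ m₀ i₀)⁻¹ k l)
      fun _ _ => 1 := by
  intro c hc
  have hV : {M : Matrix (Fin K) (Fin K) ℝ | |M k l - (P.gram μ m₀ i₀)⁻¹ k l| < c}
      ∈ 𝓝 (P.gram μ m₀ i₀)⁻¹ := by
    have hcont : Continuous fun M : Matrix (Fin K) (Fin K) ℝ =>
        |M k l - (P.gram μ m₀ i₀)⁻¹ k l| :=
      ((continuous_id.matrix_elem k l).sub continuous_const).abs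
    exact (isOpen_lt hcont continuous_const).mem_nhds (by simpa using hc)
  refine tendsto_of_tendsto_of_tendsto_of_le_of_le tendsto_const_nhds
    (tendsto_measure_OmegaHat_inv hgrowth n hbai hn hh hrate m₀ i₀ hV)
    (fun _ => zero_le) fun m => measure_mono fun ω hω hcon => ?_
  have h1 : c * |(1 : ℝ)| < |(P.OmegaHat m ω)⁻¹ k l - (P.gram μ m₀ i₀)⁻¹ k l| := hω
  have h2 : |(P.OmegaHat m ω)⁻¹ k l - (P.gram μ m₀ i₀)⁻¹ k l| < c := hcon.2
  simp only [abs_one, mul_one] at h1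
  exact lt_asymm h1 h2

end Consistency

/-! ### Asymptotic linearity of the estimator and its limit law -/

section Limit

variable {Ω : Type*} [MeasurableSpace Ω] {μ : Measure Ω} {d K L : ℕ} {P : Panel Ω d K L}
  {r : Fin d → ℕ} {xiX xiB xiA : ℕ → Ω → ℝ} {s2 : ℝ}

variable (P) in
/-- The leading term `N^{-1/2} ∑ ε_i M η_i` of the estimator, for `M = Ω_X⁻¹`. -/
noncomputable def leading (μ : Measure Ω) (M : Matrix (Fin K) (Fin K) ℝ) (m : ℕ)
    (i : Idx (P.N m)) (ω : Ω) : EuclideanSpace ℝ (Fin K) :=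
  WithLp.toLp 2 (P.eps m i ω • M.mulVec (P.eta μ m i ω))

lemma sum_leading_apply (M : Matrix (Fin K) (Fin K) ℝ) (m : ℕ) (ω : Ω) (k : Fin K) :
    ((√(Fintype.card (Idx (P.N m))))⁻¹ • ∑ i, P.leading μ M m i ω) k
      = M.mulVec (P.score μ m ω) k := by
  simp only [PiLp.smul_apply, WithLp.ofLp_sum, Finset.sum_apply, leading, Pi.smul_apply,
    smul_eq_mul, Matrix.mulVec, dotProduct, score, P.size_eq_card, Finset.mul_sum]
  rw [Finset.sum_comm]
  exact Finset.sum_congr rfl fun l _ => Finset.sum_congr rfl fun i _ => by ring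

/-- Where `Ω̂_X` is invertible, the scaled estimation error is `Ω̂_X⁻¹` times the score. -/
lemma sqrt_smul_betaIC_sub (m : ℕ) (ω : Ω) (h : IsUnit (P.OmegaHat m ω).det) (k : Fin K) :
    (√(P.size m) • (P.betaIC m ω - P.beta0)) k
      = (P.OmegaHat m ω)⁻¹.mulVec (P.scoreHat m ω) k := by
  have hbeta : (P.beta0 : Fin K → ℝ)
      = (P.OmegaHat m ω)⁻¹.mulVec ((P.OmegaHat m ω).mulVec P.beta0) := by
    rw [Matrix.mulVec_mulVec, Matrix.nonsing_inv_mul _ h, Matrix.one_mulVec]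
  have hscore : P.scoreHat m ω = √(P.size m) • ((fun k =>
      (P.size m)⁻¹ * ∑ i, P.etaHat m i ω k * (P.Y m i ω - P.GammaYHat m i ω))
        - (P.OmegaHat m ω).mulVec P.beta0) := by
    funext k
    have hinv : (√(P.size m))⁻¹ = √(P.size m) * (P.size m)⁻¹ := by
      rw [← Real.sqrt_div_self, div_eq_mul_inv]
    simp only [scoreHat, hinv, Pi.smul_apply, Pi.sub_apply, Matrix.mulVec, dotProduct, OmegaHat,
      Matrix.of_apply, smul_eq_mul, mul_assoc]
    congr 1
    simp only [mul_sub, Finset.sum_sub_distrib, Finset.mul_sum, Finset.sum_mul]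
    congr 1
    rw [Finset.sum_comm]
    exact Finset.sum_congr rfl fun l _ => Finset.sum_congr rfl fun i _ => by ring
  have hsub : (√(P.size m) • (P.betaIC m ω - P.beta0)).ofLp
      = (P.OmegaHat m ω)⁻¹.mulVec (P.scoreHat m ω) := by
    rw [hscore, Matrix.mulVec_smul, Matrix.mulVec_sub, ← hbeta]
    rfl
  exact congrFun hsub k

lemma measurable_betaIC (m : ℕ) : Measurable (P.betaIC m) := by
  have hη : ∀ i k, Measurable fun ω => P.etaHat m i ω k := fun i k => by
    have h1 := P.measurable_X m i
    have h2 := P.measurable_GammaHat m i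
    unfold etaHat
    fun_prop
  have hY : ∀ i, Measurable fun ω => P.Y m i ω - P.GammaYHat m i ω := fun i => by
    have h1 := P.measurable_X m i
    have h2 := P.measurable_GammaHat m i
    have h3 := P.measurable_A m i
    have h4 := P.measurable_eps m i
    have h5 := P.measurable_AHat m i
    have h6 := P.measurable_betaTilde m
    unfold Y GammaYHat
    fun_prop
  have hentry : ∀ k l, Measurable fun ω => P.OmegaHat m ω k l := fun k l =>
    (Finset.measurable_sum _ fun i _ => (hη i k).mul (hη i l)).const_mul _
  have hcoord : ∀ k, Measurable fun ω => (P.size m)⁻¹ *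
      ∑ i, P.etaHat m i ω k * (P.Y m i ω - P.GammaYHat m i ω) := fun k =>
    (Finset.measurable_sum _ fun i _ => (hη i k).mul (hY i)).const_mul _
  refine (WithLp.measurable_toLp 2 _).comp (measurable_pi_lambda _ fun k => ?_)
  simp only [Matrix.mulVec, dotProduct]
  exact Finset.measurable_sum _ fun l _ => (measurable_matrix_inv_apply hentry k l).mul (hcoord l)

variable [IsProbabilityMeasure μ]

/-- **Asymptotic linearity**: `√N (β̂_IC - β⁰) = N^{-1/2} ∑ ε_i Ω_X⁻¹ η_i + o_p(1)`. -/
lemma isLittleOp_betaIC_sub_leading (hgrowth : P.Growth) (n : Fin d) (hbai : P.BaiCond μ r)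
    (hrate : P.RateCond μ xiX xiB xiA) (hindep : P.IndepCond μ) (hn : P.NonsingCond μ)
    (hh : P.HomoskedCond μ s2) (hs2 : 0 ≤ s2) (m₀ : ℕ) (i₀ : Idx (P.N m₀)) :
    IsLittleOp μ (fun m ω => ‖√(P.size m) • (P.betaIC m ω - P.beta0)
      - (√(Fintype.card (Idx (P.N m))))⁻¹ •
        ∑ i, P.leading μ (P.gram μ m₀ i₀)⁻¹ m i ω‖) fun _ _ => 1 := by
  have hinv := isLittleOp_OmegaHat_inv_sub hgrowth n hbai hn hh hrate m₀ i₀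
  have hlin : ∀ k, IsLittleOp μ (fun m ω => (P.OmegaHat m ω)⁻¹.mulVec (P.scoreHat m ω) k
      - (P.gram μ m₀ i₀)⁻¹.mulVec (P.score μ m ω) k) fun _ _ => 1 := fun k => by
    have h1 := IsLittleOp.sum Finset.univ fun l _ =>
      (isBigOp_score hbai hn hh m₀ i₀ l).mul_isLittleOp (hinv k l)
    have h2 := IsLittleOp.sum Finset.univ fun l _ =>
      ((hinv k l).isBigOp.add (isBigOp_const ((P.gram μ m₀ i₀)⁻¹ k l))).mul_isLittleOp
        (isLittleOp_scoreHat_sub_score hbai hh m₀ i₀ hs2 hrate hindep l)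
    refine (h1.add h2).mono fun m ω => le_of_eq (congrArg _ ?_)
    simp only [Matrix.mulVec, dotProduct]
    rw [← Finset.sum_sub_distrib, ← Finset.sum_add_distrib]
    exact Finset.sum_congr rfl fun l _ => by ring
  have hcoord : ∀ k, IsLittleOp μ (fun m ω => (√(P.size m) • (P.betaIC m ω - P.beta0)
      - (√(Fintype.card (Idx (P.N m))))⁻¹ •
        ∑ i, P.leading μ (P.gram μ m₀ i₀)⁻¹ m i ω) k) fun _ _ => 1 := fun k => by
    refine (hlin k).congr_of_tendsto ?_
    refine tendsto_of_tendsto_of_tendsto_of_le_of_le tendsto_const_nhds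
      (tendsto_measure_OmegaHat_inv hgrowth n hbai hn hh hrate m₀ i₀ univ_mem)
      (fun _ => zero_le) fun m => measure_mono fun ω hω hcon => hω ?_
    rw [PiLp.sub_apply, sqrt_smul_betaIC_sub m ω hcon.1, sum_leading_apply]
  have habs : ∀ k, IsLittleOp μ (fun m ω => |(√(P.size m) • (P.betaIC m ω - P.beta0)
      - (√(Fintype.card (Idx (P.N m))))⁻¹ •
        ∑ i, P.leading μ (P.gram μ m₀ i₀)⁻¹ m i ω) k|) fun _ _ => 1 := fun k =>
    (hcoord k).mono fun m ω => (abs_abs _).le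
  refine (IsLittleOp.sum Finset.univ fun k _ => habs k).mono fun m ω => ?_
  rw [abs_norm]
  refine le_trans ?_ (le_abs_self _)
  set x := √(P.size m) • (P.betaIC m ω - P.beta0) - (√(Fintype.card (Idx (P.N m))))⁻¹ •
    ∑ i, P.leading μ (P.gram μ m₀ i₀)⁻¹ m i ω
  calc ‖x‖ = ‖∑ k, x k • EuclideanSpace.single k (1 : ℝ)‖ := by
        congr 1
        ext k
        simp [Pi.single_apply]
    _ ≤ ∑ k, |x k| := (norm_sum_le _ _).trans (Finset.sum_le_sum fun k _ => by
        simp [norm_smul])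

/-- The central limit theorem for the leading term; the sandwich covariance
`Ω_X⁻¹ (σ² Ω_X) Ω_X⁻¹` collapses by homoskedasticity. -/
lemma tendstoInDistribution_leading (hgrowth : P.Growth) (n : Fin d) (hbai : P.BaiCond μ r)
    (hn : P.NonsingCond μ) (hh : P.HomoskedCond μ s2) (hs2 : 0 ≤ s2) (m₀ : ℕ)
    (i₀ : Idx (P.N m₀)) :
    TendstoInDistribution (fun m ω => (√(Fintype.card (Idx (P.N m))))⁻¹ •
        ∑ i, P.leading μ (P.gram μ m₀ i₀)⁻¹ m i ω) atTop
      (id : EuclideanSpace ℝ (Fin K) → EuclideanSpace ℝ (Fin K))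
      (fun _ => μ) (multivariateGaussian 0 (s2 • (P.gram μ m₀ i₀)⁻¹)) := by
  set G := P.gram μ m₀ i₀ with hG
  have hpd : G.PosDef := hn.posDef_gram hbai m₀ i₀
  have hunit : IsUnit G.det := isUnit_iff_ne_zero.2 hpd.det_pos.ne'
  have hpsd : (s2 • G⁻¹).PosSemidef := hpd.inv.posSemidef.smul hs2
  have hsymm : (G⁻¹).transpose = G⁻¹ := by
    simpa [Matrix.IsHermitian, Matrix.conjTranspose_eq_transpose_of_trivial] using hpd.inv.1
  have hg : Measurable fun x : ℝ × EuclideanSpace ℝ (Fin K) =>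
      (WithLp.toLp 2 (x.1 • G⁻¹.mulVec x.2) : EuclideanSpace ℝ (Fin K)) := by
    refine Continuous.measurable ?_
    have : Continuous fun x : ℝ × EuclideanSpace ℝ (Fin K) => G⁻¹.mulVec x.2 :=
      continuous_const.matrix_mulVec (by fun_prop)
    fun_prop
  have hinner : ∀ (t : EuclideanSpace ℝ (Fin K)) ω, inner ℝ (P.leading μ G⁻¹ m₀ i₀ ω) t
      = P.eps m₀ i₀ ω * ∑ k, G⁻¹.mulVec t k * P.eta μ m₀ i₀ ω k := fun t ω => by
    rw [leading, EuclideanSpace.inner_eq_star_dotProduct, star_trivial, dotProduct_smul,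
      smul_eq_mul, Matrix.dotProduct_mulVec, ← Matrix.mulVec_transpose, hsymm]
    rfl
  refine tendstoInDistribution_sum_array (Z₀ := P.leading μ G⁻¹ m₀ i₀)
    (hgrowth.tendsto_card n) (fun m => (hh.indep m).comp (fun _ => _) fun _ => hg)
    (fun m i => (hh.ident m m₀ i i₀).comp hg) ?_ (fun t => ?_) fun t => ?_
  · refine MemLp.of_eval_piLp fun k => ?_
    simp only [leading, Pi.smul_apply, smul_eq_mul, Matrix.mulVec, dotProduct, Finset.mul_sum]
    refine memLp_finsetSum _ fun l _ => ?_
    simpa only [mul_left_comm] using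
      (memLp_two_mul (hbai.memLp_eps m₀ i₀) (hbai.memLp_eta_apply m₀ i₀ l)).const_mul (G⁻¹ k l)
  · simp only [hinner, Finset.mul_sum, mul_left_comm (P.eps m₀ i₀ _)]
    rw [integral_finsetSum _ fun k _ => ((memLp_two_mul (hbai.memLp_eps m₀ i₀)
      (hbai.memLp_eta_apply m₀ i₀ k)).integrable (by norm_num)).const_mul _]
    simp only [integral_const_mul, hn.integral_eps_mul_eta hbai, mul_zero, Finset.sum_const_zero]
  · have hquad : G⁻¹.mulVec t ⬝ᵥ G.mulVec (G⁻¹.mulVec t) = t ⬝ᵥ G⁻¹.mulVec t := by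
      rw [Matrix.mulVec_mulVec, Matrix.mul_nonsing_inv _ hunit, Matrix.one_mulVec,
        dotProduct_comm]
    rw [charFun_multivariateGaussian hpsd]
    simp only [hinner, hh.integral_sq_eps_mul_sum_eta hbai, ← hG, hquad]
    simp [Matrix.smul_mulVec, neg_div]

end Limit

end Panel

end TensorPanel

theorem mainTheorem4 {Ω : Type*} [MeasurableSpace Ω] (μ : Measure Ω) [IsProbabilityMeasure μ]
    {d K L : ℕ} (P : TensorPanel.Panel Ω d K L)
    (S : Finset (Fin d)) (C : ℕ → Fin d → ℝ) (r : Fin d → ℕ)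
    (xiX xiB xiA : ℕ → Ω → ℝ) (s2 : ℝ)
    (hgrowth : P.Growth)
    (hkernel : P.KernelCond) (hproxy : P.ProxyCond μ) (hwithin : P.WithinCond μ)
    (hproxyRate : P.ProxyRate μ S C)
    (hbai : P.BaiCond μ r) (hrate : P.RateCond μ xiX xiB xiA) (hindep : P.IndepCond μ)
    (hnonsing : P.NonsingCond μ) (hhomosked : P.HomoskedCond μ s2) :
    ∃ OmegaX : Matrix (Fin K) (Fin K) ℝ,
      OmegaX.PosDef ∧
      (∀ k l, TendstoInMeasure μ
        (fun m ω => (P.size m)⁻¹ * ∑ i, P.eta μ m i ω k * P.eta μ m i ω l) atTop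
        (fun _ => OmegaX k l)) ∧
      TendstoInDistribution
        (fun m ω => Real.sqrt (P.size m) • (P.betaIC m ω - P.beta0)) atTop
        (id : EuclideanSpace ℝ (Fin K) → EuclideanSpace ℝ (Fin K))
        (fun _ => μ) (multivariateGaussian 0 (s2 • OmegaX⁻¹)) := by
  open TensorPanel Panel in
  -- A non-empty set of modes means `d ≠ 0`, without which the sample size would stay equal to `1`.
  obtain ⟨n, -⟩ := hproxyRate.nonempty
  obtain ⟨m₀, ⟨i₀⟩⟩ := hgrowth.eventually_nonempty_idx.exists
  have hs2 : 0 ≤ s2 := hhomosked.var_eq m₀ i₀ ▸ integral_nonneg fun ω => sq_nonneg _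
  refine ⟨P.gram μ m₀ i₀, hnonsing.posDef_gram hbai m₀ i₀, fun k l => ?_, ?_⟩
  · refine tendstoInMeasure_of_isLittleOp ?_
    exact (isLittleOp_gram_sub hgrowth n hbai hhomosked m₀ i₀ k l).mono fun m ω => by
      rw [abs_norm, Real.norm_eq_abs]
  · refine tendstoInDistribution_of_tendstoInMeasure_sub _ _
      (tendstoInDistribution_leading hgrowth n hbai hnonsing hhomosked hs2 m₀ i₀) ?_ fun m => ?_
    · refine tendstoInMeasure_of_isLittleOp ?_
      simpa only [Pi.sub_apply, Pi.zero_apply, sub_zero] using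
        isLittleOp_betaIC_sub_leading hgrowth n hbai hrate hindep hnonsing hhomosked hs2 m₀ i₀
    · have := P.measurable_betaIC m
      fun_prop
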